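/- Let $p\ge 3$ be an odd integer, $\mathbb T=\mathbb R/2\pi\mathbb Z$, $\langle x\rangle=\sqrt{1+|x|^2}$. For $v:\mathbb T\to\mathbb C$ put $\widehat v(k)=\frac1{\sqrt{2\pi}}\int_{\mathbb T}v(x)e^{-ikx}\,dx$, and let $\widehat u(\tau,k)$ denote the space-time Fourier transform of a distribution $u$ on $\mathbb R\times\mathbb T$, normalized by $u(t,x)=\frac1{2\pi}\sum_{k\in\mathbb Z}\int_{\mathbb R}\widehat u(\tau,k)e^{i(kx+t\tau)}\,d\tau$. For $s,b\in\mathbb R$ and $T>0$ set $$\|u\|_{X^{s,b}}^2=\sum_{k\in\mathbb Z}\int_{\mathbb R}\langle k\rangle^{2s}\langle\tau+k^2\rangle^{2b}|\widehat u(\tau,k)|^2\,d\tau,\qquad \|u\|_{X_T^{s,b}}=\inf\{\|\tilde u\|_{X^{s,b}}:\ \tilde u=u\text{ on }(0,T)\times\mathbb T\},$$ the last for functions $u$ on $(0,T)\times\mathbb T$ (locally integrable, equality in the sense of distributions); $X_T^{s,b}$ consists of those $u$ for which $\|u\|_{X_T^{s,b}}<\infty$. Let $\mathcal T(u_1,\dots,u_p)=\prod_{l\text{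 odd}}u_l\prod_{l\text{ even}}\overline{u_l}$, let $\mathcal T_R(u_1,\dots,u_p)$ be given at each time by its spatial Fourier coefficients $$\mathcal F\mathcal T_R(u_1,\dots,u_p)(k)=(2\pi)^{-\frac{p-1}2}\sum_{\substack{1\le m\le p\\ m\text{ odd}}}\ \sum_{\substack{k_1,\dots,k_p\in\mathbb Z\\ k=k_1-k_2+\cdots+k_p\\ k_m=k}}\ \prod_{l\text{ odd}}\widehat{u_l}(k_l)\prod_{l\text{ even}}\overline{\widehat{u_l}(k_l)},$$ and let $\mathcal T_N=\mathcal T-\mathcal T_R$. **Lemma 2.6 (nonlinear smoothing).** Let $T>0$, $s\ge 1$, $b>1/2$ and $\sigma\in(0,1/4]$. Then for every $b'\in[\sigma,1/2)$ there exists a constant $C>0$ (depending only on $p,T,s,b,\sigma,b'$) such that for all $u_1,\dots,u_p\in X_T^{s,b}$ one has $\mathcal T_N(u_1,\dots,u_p)\in X_T^{s+\sigma,-b'}$ and $$\|\mathcal T_N(u_1,\dots,u_p)\|_{X_T^{s+\sigma,-b'}}\le C\prod_{l=1}^p\|u_l\|_{X_T^{s,b}}.$$ -/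

import Mathlib

open MeasureTheory Set
open scoped ENNReal

namespace NLSBourgain

/-- The torus `ℝ / 2πℤ`; its `volume` has total mass `2π`. -/
abbrev Torus : Type := AddCircle (2 * Real.pi)

instance factTwoPiPos : Fact (0 < 2 * Real.pi) := ⟨Real.two_pi_pos⟩

/-- The Japanese bracket `⟨x⟩ = √(1 + |x|²)`. -/
noncomputable def bracket (x : ℝ) : ℝ := Real.sqrt (1 + x ^ 2)

/-- The Fourier coefficient `(2π)^{-1/2} ∫_𝕋 v(x) e^{-ikx} dx` of a function on the torus;
`fourier n x` is `e^{inx}` because the period is `2π`. -/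
noncomputable def spatialCoeff (v : Torus → ℂ) (k : ℤ) : ℂ :=
  (Real.sqrt (2 * Real.pi) : ℂ)⁻¹ * ∫ x : Torus, v x * fourier (-k) x

/-- The norm `(∑ₖ ∫ ⟨k⟩^{2s} ⟨τ + k²⟩^{2b} |û(τ,k)|² dτ)^{1/2}` of the Bourgain space `X^{s,b}`,
with values in `[0,∞]`, in terms of the space-time Fourier transform `û(τ,k) = f k τ`. -/
noncomputable def bourgainNorm (s b : ℝ) (f : ℤ → ℝ → ℂ) : ℝ≥0∞ :=
  (∑' k : ℤ, ∫⁻ τ : ℝ,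
    ENNReal.ofReal (bracket (k : ℝ) ^ (2 * s) * bracket (τ + (k : ℝ) ^ 2) ^ (2 * b)) *
      ‖f k τ‖ₑ ^ 2) ^ (1 / 2 : ℝ)

/-- The pairing with `φ` of the distribution in time whose Fourier transform is `g`, that is, of
`t ↦ (2π)^{-1/2} ∫ g(τ) e^{itτ} dτ`. -/
noncomputable def timePairing (g : ℝ → ℂ) (φ : ℝ → ℂ) : ℂ :=
  (Real.sqrt (2 * Real.pi) : ℂ)⁻¹ *
    ∫ τ : ℝ, g τ * ∫ t : ℝ, φ t * Complex.exp (Complex.I * ((t * τ : ℝ) : ℂ))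

/-- `f` is (a.e. measurable and is) the space-time Fourier transform of a distribution on `ℝ × 𝕋`
that coincides on `(0,T) × 𝕋` with the locally integrable function `u`. The coincidence is tested
against the functions `φ(t) e^{-ikx}` with `φ ∈ C_c^∞((0,T))`, which span a dense subspace of the
test functions on `(0,T) × 𝕋`. Values of `u` at times outside `(0,T)` play no role. -/
structure IsExtension (T : ℝ) (u : ℝ → Torus → ℂ) (f : ℤ → ℝ → ℂ) : Prop where
  aestronglyMeasurable : ∀ k : ℤ, AEStronglyMeasurable (f k) volume
  locallyIntegrableOn : LocallyIntegrableOn (Function.uncurry u) (Ioo 0 T ×ˢ univ) volume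
  eq_on : ∀ (k : ℤ) (φ : ℝ → ℂ), ContDiff ℝ (⊤ : ℕ∞) φ → HasCompactSupport φ →
    tsupport φ ⊆ Ioo 0 T →
      ∫ t : ℝ, spatialCoeff (u t) k * φ t = timePairing (f k) φ

/-- The norm of the restriction space `X_T^{s,b}`, with values in `[0,∞]`: the infimum of the
`X^{s,b}` norms of all extensions. -/
noncomputable def restrictedNorm (T s b : ℝ) (u : ℝ → Torus → ℂ) : ℝ≥0∞ :=
  ⨅ (f : ℤ → ℝ → ℂ) (_ : IsExtension T u f), bourgainNorm s b f

/-- Membership in the restriction space `X_T^{s,b}`: some extension has a finite norm. -/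
def MemRestricted (T s b : ℝ) (u : ℝ → Torus → ℂ) : Prop :=
  restrictedNorm T s b u < ∞

/-- `conjAt l z` is `z` in the 1st, 3rd, 5th, ... position and the conjugate of `z` in the 2nd,
4th, ... position. (Positions are counted from `0` in `Fin p`, so the `l`-th factor of the
mathematics, `l = 1, ..., p`, has the index `l - 1`.) -/
noncomputable def conjAt {p : ℕ} (l : Fin p) (z : ℂ) : ℂ :=
  if Even l.val then z else (starRingEnd ℂ) z

/-- The multiplication operator `𝒯(u₁, ..., u_p) = u₁ ū₂ u₃ ⋯ u_p`. -/
noncomputable def opT {p : ℕ} (u : Fin p → ℝ → Torus → ℂ) (t : ℝ) (x : Torus) : ℂ :=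
  ∏ l : Fin p, conjAt l (u l t x)

/-- The alternating sum `k₁ - k₂ + k₃ - ⋯ + k_p`. -/
def altSum {p : ℕ} (κ : Fin p → ℤ) : ℤ := ∑ l : Fin p, (-1) ^ l.val * κ l

/-- The `k`-th spatial Fourier coefficient of `𝒯_R(u₁, ..., u_p)(t)`:
`(2π)^{-(p-1)/2} ∑_{m odd} ∑_{k = k₁ - k₂ + ⋯ + k_p, k_m = k} ∏_{l odd} û_l(k_l) ∏_{l even} conj û_l(k_l)`. -/
noncomputable def coeffTR {p : ℕ} (u : Fin p → ℝ → Torus → ℂ) (t : ℝ) (k : ℤ) : ℂ :=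
  (((2 * Real.pi) ^ (-(((p : ℝ) - 1) / 2)) : ℝ) : ℂ) *
    ∑ m : Fin p with Even m.val,
      ∑' κ : {κ : Fin p → ℤ // altSum κ = k ∧ κ m = k},
        ∏ l : Fin p, conjAt l (spatialCoeff (u l t) (κ.val l))

/-- The single-resonance form `𝒯_R(u₁, ..., u_p)`, the function with the spatial Fourier
coefficients `coeffTR u t k`. -/
noncomputable def opTR {p : ℕ} (u : Fin p → ℝ → Torus → ℂ) (t : ℝ) (x : Torus) : ℂ :=
  (Real.sqrt (2 * Real.pi) : ℂ)⁻¹ * ∑' k : ℤ, coeffTR u t k * fourier k x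

/-- The form with single resonances removed, `𝒯_N = 𝒯 - 𝒯_R`. -/
noncomputable def opTN {p : ℕ} (u : Fin p → ℝ → Torus → ℂ) (t : ℝ) (x : Torus) : ℂ :=
  opT u t x - opTR u t x

end NLSBourgain

/-!
Write `û_l = f_l` for extensions `f_l` of the `u_l`, pass to the signed time variables `x_l = ±τ_l`,
and let `Φ = k² - k₁² + k₂² - ⋯ - k_p²` be the resonance function. It equals the difference of
`τ + k²` and `∑ (x_l ± k_l²)`, so `|Φ|` is at most `p + 1` times the largest of the modulations
`⟨τ + k²⟩`, `⟨x_l ± k_l²⟩`.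

*Multiplier.* The frequencies `κ = (k₁, ..., k_p)` occur in `𝒯_N` with the coefficient `1 - #`, where
`#` is the number of odd positions `m` with `k_m = k`. When `# ≠ 1`, every `|k_m|` is bounded by `|Φ|`
plus a constant times `∏_{l ≠ m} ⟨k_l⟩` (`abs_le_of_resonanceCount_ne_one`). At an odd position with
`d = k - k_m ≠ 0` this follows from `k² - k_m² = d² + 2 d k_m`, since each other `k_l` is either
`O(|d|)` or comparable to a further frequency; at an even position `k²` and `k_m²` add up; and if
`k_m = k`, a second resonant position has the same frequency. Raised to the power `σ`, for the highest
frequency, this pays for the additional `σ` derivatives: the other factors lose `σ ≤ 1/4` derivatives,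
which leaves them more than `1/2`, and one modulation loses `σ`, which is at most both `b'` and `b`
(`exists_multiplier_le`).

*Estimate.* By the Cauchy-Schwarz inequality on the fibre over `(k, τ)` it then suffices to bound
`∑ ∫ ∏_{l ≠ m} ⟨k_l⟩^{-2(s-σ)} ∏_{l ≠ j} ⟨x_l ± k_l²⟩^{-2b}` over that fibre uniformly in `(k, τ)`.
The sum converges on eliminating `k_m` and the integral on eliminating `x_j`; the remaining factor is
the product of the norms by Tonelli's theorem (`tsum_lintegral_outputWeight_le`).

*Identification.* Since `s, b > 1/2`, the `f_l` are integrable, so for almost every `t ∈ (0,T)` the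
Fourier coefficients of `u_l(t)` are the continuous functions given by Fourier inversion in time; they
are summable in `k`, and `u_l(t)` is the sum of its Fourier series almost everywhere. Thus `𝒯_N` is
an absolutely convergent sum over `κ`, and its space-time Fourier transform is a sum of convolutions
(`isExtension_opTN`). The infimum over the extensions `f_l` gives the restricted norms.
-/

open MeasureTheory Set
open scoped ENNReal

namespace NLSBourgain

/-! ### Products, hyperplane integrals and the Cauchy-Schwarz inequality -/

theorem tsum_pi_prod_ennreal {α : Type*} : ∀ {n : ℕ} (f : Fin n → α → ℝ≥0∞),
    ∑' κ : Fin n → α, ∏ l, f l (κ l) = ∏ l, ∑' k, f l k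
  | 0, f => by simp [tsum_fintype]
  | n + 1, f => by
    rw [← (Fin.consEquiv fun _ : Fin (n + 1) => α).tsum_eq, ENNReal.tsum_prod',
      Fin.prod_univ_succ, ← tsum_pi_prod_ennreal (fun l => f l.succ)]
    simp_rw [Fin.prod_univ_succ, Fin.consEquiv_apply, Fin.cons_zero, Fin.cons_succ,
      ENNReal.tsum_mul_left, ENNReal.tsum_mul_right]

theorem lintegral_pi_prod {α : Type*} [MeasureSpace α] [SigmaFinite (volume : Measure α)] :
    ∀ {n : ℕ} (f : Fin n → α → ℝ≥0∞), (∀ l, Measurable (f l)) →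
    ∫⁻ x : Fin n → α, ∏ l, f l (x l) = ∏ l, ∫⁻ x, f l x
  | 0, f, _ => by simp [volume_pi]
  | n + 1, f, hf => by
    have hm : Measurable fun x : Fin n → α => ∏ l, f l.succ (x l) :=
      Finset.measurable_prod _ fun l _ => (hf _).comp (measurable_pi_apply l)
    have e := (volume_preserving_piFinSuccAbove (fun _ : Fin (n + 1) => α) 0).symm
    rw [← e.lintegral_comp_emb (MeasurableEquiv.measurableEmbedding _), Measure.volume_eq_prod]
    simp_rw [Fin.prod_univ_succ, MeasurableEquiv.piFinSuccAbove_symm_apply, Fin.insertNthEquiv,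
      Equiv.coe_fn_mk, Fin.insertNth_zero, Fin.cons_zero, Fin.cons_succ, cast_eq]
    rw [lintegral_prod_mul (hf 0).aemeasurable hm.aemeasurable,
      lintegral_pi_prod (fun l => f l.succ) fun l => hf _]

theorem summable_pi_prod_norm {α : Type*} {n : ℕ} (f : Fin n → α → ℂ)
    (hf : ∀ l, Summable fun k => ‖f l k‖) :
    Summable fun κ : Fin n → α => ‖∏ l, f l (κ l)‖ := by
  rw [← tsum_enorm_ne_top_iff_summable_norm]
  simp_rw [enorm_eq_nnnorm, nnnorm_prod, ENNReal.ofNNReal_finsetProd]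
  rw [tsum_pi_prod_ennreal (fun l k => (‖f l k‖₊ : ℝ≥0∞))]
  exact ENNReal.prod_ne_top fun l _ => tsum_enorm_ne_top_iff_summable_norm.2 (hf l)

theorem tsum_pi_prod {α : Type*} : ∀ {n : ℕ} (f : Fin n → α → ℂ),
    (∀ l, Summable fun k => ‖f l k‖) →
    ∑' κ : Fin n → α, ∏ l, f l (κ l) = ∏ l, ∑' k, f l k
  | 0, f, _ => by simp [tsum_fintype]
  | n + 1, f, hf => by
    rw [← (Fin.consEquiv fun _ : Fin (n + 1) => α).tsum_eq, Fin.prod_univ_succ,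
      ← tsum_pi_prod (fun l => f l.succ) fun l => hf _,
      tsum_mul_tsum_of_summable_norm (hf 0) (summable_pi_prod_norm _ fun l => hf _)]
    simp_rw [Fin.prod_univ_succ, Fin.consEquiv_apply, Fin.cons_zero, Fin.cons_succ]

/-- The point of `ℝⁿ⁺¹` on the hyperplane of coordinate sum `τ` whose coordinates other than the
`j`-th are given by `y`. -/
noncomputable def fiberPoint {n : ℕ} (j : Fin (n + 1)) (τ : ℝ) (y : Fin n → ℝ) : Fin (n + 1) → ℝ :=
  j.insertNth (τ - ∑ i, y i) y

theorem sum_fiberPoint {n : ℕ} (j : Fin (n + 1)) (τ : ℝ) (y : Fin n → ℝ) :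
    ∑ l, fiberPoint j τ y l = τ := by
  simp [fiberPoint, Fin.sum_univ_succAbove _ j]

theorem measurePreserving_fiberPoint {n : ℕ} (j : Fin (n + 1)) :
    MeasurePreserving (fun z : ℝ × (Fin n → ℝ) => fiberPoint j z.1 z.2) := by
  have e := (volume_preserving_piFinSuccAbove (fun _ : Fin (n + 1) => ℝ) j).symm
  have s : MeasurePreserving (fun z : (Fin n → ℝ) × ℝ => (z.1, z.2 - ∑ i, z.1 i))
      (volume.prod volume) (volume.prod volume) := by
    refine MeasurePreserving.skew_product (g := fun (y : Fin n → ℝ) (τ : ℝ) => τ - ∑ i, y i) (MeasurePreserving.id _)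
      (by fun_prop) (Filter.Eventually.of_forall fun y => ?_)
    simp_rw [sub_eq_add_neg]
    exact map_add_right_eq_self volume _
  have := e.comp (Measure.measurePreserving_swap.comp (s.comp Measure.measurePreserving_swap))
  exact this

theorem measurable_fiberPoint {n : ℕ} (j : Fin (n + 1)) (τ : ℝ) :
    Measurable fun y : Fin n → ℝ => fiberPoint j τ y :=
  (measurePreserving_fiberPoint j).measurable.comp (measurable_const.prodMk measurable_id)

theorem lintegral_fiberPoint {n : ℕ} (j : Fin (n + 1)) {Q : (Fin (n + 1) → ℝ) → ℝ≥0∞}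
    (hQ : Measurable Q) : ∫⁻ τ, ∫⁻ y, Q (fiberPoint j τ y) = ∫⁻ x, Q x := by
  have hm := measurePreserving_fiberPoint j
  rw [← hm.lintegral_comp hQ, Measure.volume_eq_prod,
    lintegral_prod (fun z : ℝ × (Fin n → ℝ) => Q (fiberPoint j z.1 z.2))
      (hQ.comp hm.measurable).aemeasurable]

theorem measurable_lintegral_fiberPoint {n : ℕ} (j : Fin (n + 1)) {Q : (Fin (n + 1) → ℝ) → ℝ≥0∞}
    (hQ : Measurable Q) : Measurable fun τ => ∫⁻ y, Q (fiberPoint j τ y) :=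
  Measurable.lintegral_prod_right (hQ.comp (measurePreserving_fiberPoint j).measurable)

/-- The integral over the hyperplane of coordinate sum `τ` does not depend on the coordinate that
is eliminated. -/
theorem lintegral_fiberPoint_ae_eq {n : ℕ} (i j : Fin (n + 1)) {Q : (Fin (n + 1) → ℝ) → ℝ≥0∞}
    (hQ : Measurable Q) :
    (fun τ => ∫⁻ y, Q (fiberPoint i τ y)) =ᵐ[volume] fun τ => ∫⁻ y, Q (fiberPoint j τ y) := by
  have key : ∀ (l : Fin (n + 1)) (A : Set ℝ), MeasurableSet A →
      ∫⁻ τ in A, ∫⁻ y, Q (fiberPoint l τ y)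
        = ∫⁻ x, A.indicator (fun _ => (1 : ℝ≥0∞)) (∑ i, x i) * Q x := by
    intro l A hA
    have hmA : Measurable fun x : Fin (n + 1) → ℝ =>
        A.indicator (fun _ => (1 : ℝ≥0∞)) (∑ i, x i) * Q x :=
      ((measurable_const.indicator hA).comp (by fun_prop)).mul hQ
    rw [← lintegral_fiberPoint l hmA, ← lintegral_indicator hA]
    refine lintegral_congr fun τ => ?_
    simp_rw [sum_fiberPoint]
    by_cases h : τ ∈ A <;> simp [h]
  refine ae_eq_of_forall_setLIntegral_eq_of_sigmaFinite (measurable_lintegral_fiberPoint i hQ)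
    (measurable_lintegral_fiberPoint j hQ) fun A hA _ => ?_
  rw [key i A hA, key j A hA]

theorem integrable_fiberPoint {n : ℕ} (j : Fin (n + 1)) {q : (Fin (n + 1) → ℝ) → ℂ}
    (hq : Integrable q) :
    Integrable fun z : ℝ × (Fin n → ℝ) => q (fiberPoint j z.1 z.2) :=
  (measurePreserving_fiberPoint j).integrable_comp_of_integrable hq

theorem integral_fiberPoint {n : ℕ} (j : Fin (n + 1)) {q : (Fin (n + 1) → ℝ) → ℂ}
    (hq : Integrable q) : ∫ τ, ∫ y, q (fiberPoint j τ y) = ∫ x, q x := by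
  have hm := measurePreserving_fiberPoint j
  have hi := integrable_fiberPoint j hq
  have := (hm.map_eq ▸ integral_map (f := q) hm.measurable.aemeasurable
    (hm.map_eq ▸ hq.aestronglyMeasurable) : ∫ x, q x = _)
  rw [this, Measure.volume_eq_prod, integral_prod _ hi]

/-- The Cauchy-Schwarz inequality in `[0,∞]`. -/
theorem lintegral_mul_sq_le {α : Type*} [MeasurableSpace α] (μ : Measure α) {f g : α → ℝ≥0∞}
    (hf : AEMeasurable f μ) (hg : AEMeasurable g μ) :
    (∫⁻ a, f a * g a ∂μ) ^ 2 ≤ (∫⁻ a, f a ^ 2 ∂μ) * ∫⁻ a, g a ^ 2 ∂μ := by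
  have h := ENNReal.lintegral_mul_le_Lp_mul_Lq μ (p := 2) (q := 2)
    ⟨by norm_num, by norm_num, by norm_num⟩ hf hg
  simp only [Pi.mul_apply, ENNReal.rpow_two] at h
  refine (pow_le_pow_left' h 2).trans_eq ?_
  rw [mul_pow, ← ENNReal.rpow_two, ← ENNReal.rpow_two, ← ENNReal.rpow_mul, ← ENNReal.rpow_mul]
  norm_num

theorem tsum_mul_sq_le {α : Type*} (f g : α → ℝ≥0∞) :
    (∑' a, f a * g a) ^ 2 ≤ (∑' a, f a ^ 2) * ∑' a, g a ^ 2 := by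
  let _ : MeasurableSpace α := ⊤
  simpa only [lintegral_count] using lintegral_mul_sq_le Measure.count
    (measurable_from_top (f := f)).aemeasurable (measurable_from_top (f := g)).aemeasurable

/-- The Cauchy-Schwarz inequality for the iterated `∑ ∫`. -/
theorem tsum_lintegral_mul_sq_le {ι α : Type*} [MeasurableSpace α] (μ : Measure α)
    {f g : ι → α → ℝ≥0∞} (hf : ∀ i, Measurable (f i)) (hg : ∀ i, Measurable (g i)) :
    (∑' i, ∫⁻ a, f i a * g i a ∂μ) ^ 2
      ≤ (∑' i, ∫⁻ a, f i a ^ 2 ∂μ) * ∑' i, ∫⁻ a, g i a ^ 2 ∂μ := by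
  have sq : ∀ x : ℝ≥0∞, (x ^ (1 / 2 : ℝ)) ^ 2 = x := fun x => by
    rw [← ENNReal.rpow_two, ← ENNReal.rpow_mul]; norm_num
  have h : ∀ i, ∫⁻ a, f i a * g i a ∂μ
      ≤ (∫⁻ a, f i a ^ 2 ∂μ) ^ (1 / 2 : ℝ) * (∫⁻ a, g i a ^ 2 ∂μ) ^ (1 / 2 : ℝ) := fun i => by
    rw [← ENNReal.mul_rpow_of_nonneg _ _ (by norm_num)]
    refine le_trans ?_ (ENNReal.rpow_le_rpow
      (lintegral_mul_sq_le μ (hf i).aemeasurable (hg i).aemeasurable) (by norm_num))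
    rw [← ENNReal.rpow_two, ← ENNReal.rpow_mul]; norm_num
  refine (pow_le_pow_left' (ENNReal.tsum_le_tsum h) 2).trans ((tsum_mul_sq_le _ _).trans_eq ?_)
  simp_rw [sq]

/-- An integrable function on the torus whose Fourier coefficients all vanish is zero almost
everywhere: it is orthogonal to the trigonometric polynomials, hence by density to the continuous
functions, hence to the indicators of closed sets. -/
theorem ae_eq_zero_of_spatialCoeff_eq_zero {v : Torus → ℂ} (hv : Integrable v)
    (h : ∀ k, spatialCoeff v k = 0) : v =ᵐ[volume] 0 := by
  have hvc : ∀ g : C(Torus, ℂ), Integrable fun x => v x * g x := fun g =>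
    hv.mul_bdd g.continuous.aestronglyMeasurable (Filter.Eventually.of_forall g.norm_coe_le_norm)
  have hcont : ∀ g : C(Torus, ℂ), ∫ x, v x * g x = 0 := by
    let S : Submodule ℂ C(Torus, ℂ) :=
      { carrier := {g | ∫ x, v x * g x = 0}
        add_mem' := fun {a b} ha hb => by
          simp only [mem_ofPred_eq, ContinuousMap.add_apply, mul_add] at *
          rw [integral_add (hvc a) (hvc b), ha, hb, add_zero]
        zero_mem' := by simp
        smul_mem' := fun c a ha => by
          simp only [mem_ofPred_eq, ContinuousMap.smul_apply, smul_eq_mul, mul_left_comm _ c] at *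
          rw [integral_const_mul, ha, mul_zero] }
    have hclosed : IsClosed (S : Set C(Torus, ℂ)) := by
      have hc : Continuous fun g : C(Torus, ℂ) => ∫ x, v x * g x := by
        refine LipschitzWith.continuous (K := NNReal.mk (∫ x, ‖v x‖) (by positivity))
          (LipschitzWith.of_dist_le_mul fun a b => ?_)
        rw [dist_eq_norm, ← integral_sub (hvc a) (hvc b), NNReal.coe_mk, ← integral_mul_const]
        refine norm_integral_le_of_norm_le (hv.norm.mul_const _)
          (Filter.Eventually.of_forall fun x => ?_)
        rw [← mul_sub, norm_mul, dist_eq_norm]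
        exact mul_le_mul_of_nonneg_left ((a - b).norm_coe_le_norm x) (norm_nonneg _)
      exact isClosed_eq hc continuous_const
    have hspan : Submodule.span ℂ (range (@fourier (2 * Real.pi))) ≤ S := by
      rw [Submodule.span_le]
      rintro _ ⟨k, rfl⟩
      have := h (-k)
      simp only [spatialCoeff, neg_neg, mul_eq_zero, inv_eq_zero, Complex.ofReal_eq_zero] at this
      exact this.resolve_left (Real.sqrt_pos.2 Real.two_pi_pos).ne'
    have := Submodule.topologicalClosure_minimal _ hspan hclosed
    rw [span_fourier_closure_eq_top] at this
    exact fun g => this trivial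
  refine ae_eq_zero_of_forall_setIntegral_isClosed_eq_zero hv fun F hF => ?_
  have hlim : Filter.Tendsto (fun m => ∫ x, v x * (((hF.apprSeq m x : NNReal) : ℝ) : ℂ))
      Filter.atTop (nhds (∫ x, F.indicator v x)) := by
    refine tendsto_integral_of_dominated_convergence (fun x => ‖v x‖) (fun m => ?_) hv.norm
      (fun m => Filter.Eventually.of_forall fun x => ?_) (Filter.Eventually.of_forall fun x => ?_)
    · exact hv.aestronglyMeasurable.mul (by
        apply Continuous.aestronglyMeasurable; fun_prop)
    · rw [norm_mul, Complex.norm_real, NNReal.norm_eq]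
      exact mul_le_of_le_one_right (norm_nonneg _)
        (by exact_mod_cast HasOuterApproxClosed.apprSeq_apply_le_one hF m x)
    · have := (tendsto_pi_nhds.1 (HasOuterApproxClosed.tendsto_apprSeq hF)) x
      have h2 := ((Complex.continuous_ofReal.comp NNReal.continuous_coe).tendsto _).comp this
      have h3 := h2.const_mul (v x)
      refine (h3.congr fun m => rfl).trans (le_of_eq ?_)
      by_cases hx : x ∈ F <;> simp [hx]
  rw [← integral_indicator hF.measurableSet]
  refine tendsto_nhds_unique hlim ?_
  have : ∀ m, ∫ x, v x * (((hF.apprSeq m x : NNReal) : ℝ) : ℂ) = 0 := fun m =>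
    hcont ⟨fun x => (((hF.apprSeq m x : NNReal) : ℝ) : ℂ), by fun_prop⟩
  simp_rw [this]
  exact tendsto_const_nhds

/-! ### Japanese brackets and the resonance function -/

theorem one_le_bracket (x : ℝ) : 1 ≤ bracket x :=
  Real.one_le_sqrt.2 (by nlinarith [sq_nonneg x])

theorem bracket_pos (x : ℝ) : 0 < bracket x := one_pos.trans_le (one_le_bracket x)

theorem abs_le_bracket (x : ℝ) : |x| ≤ bracket x :=
  Real.abs_le_sqrt (by linarith)

theorem bracket_le_one_add_abs (x : ℝ) : bracket x ≤ 1 + |x| := by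
  rw [bracket, Real.sqrt_le_left (by positivity)]
  nlinarith [sq_abs x, abs_nonneg x]

theorem bracket_neg (x : ℝ) : bracket (-x) = bracket x := by simp [bracket]

theorem continuous_bracket : Continuous bracket := by
  unfold bracket; fun_prop

theorem measurable_bracket : Measurable bracket := continuous_bracket.measurable

theorem lintegral_bracket_rpow_lt_top {r : ℝ} (hr : 1 < r) :
    ∫⁻ x, ENNReal.ofReal (bracket x ^ (-r)) < ∞ := by
  have h := integrable_rpow_neg_one_add_norm_sq (E := ℝ) (μ := volume) (r := r) (by simpa using hr)
  refine lt_of_le_of_lt (lintegral_mono fun x => ?_) h.lintegral_lt_top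
  refine ENNReal.ofReal_le_ofReal (le_of_eq ?_)
  rw [bracket, Real.sqrt_eq_rpow, ← Real.rpow_mul (by positivity), Real.norm_eq_abs, sq_abs]
  ring_nf

theorem tsum_bracket_rpow_lt_top {r : ℝ} (hr : 1 < r) :
    ∑' k : ℤ, ENNReal.ofReal (bracket k ^ (-r)) < ∞ := by
  have h := (Real.summable_one_div_int_add_rpow (1 / 2) r).2 hr
  have h2 : Summable fun k : ℤ => bracket k ^ (-r) := by
    refine Summable.of_nonneg_of_le (fun k => by have := bracket_pos k; positivity) (fun k => ?_)
      (h.mul_left ((3 / 2 : ℝ) ^ r))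
    have hk : 0 < |(k : ℝ) + 1 / 2| := by
      rw [abs_pos]
      intro h0
      have : ((2 * k + 1 : ℤ) : ℝ) = 0 := by push_cast; linarith
      have : 2 * k + 1 = 0 := by exact_mod_cast this
      omega
    have hle : |(k : ℝ) + 1 / 2| ≤ 3 / 2 * bracket k := by
      have h1 := abs_add_le (k : ℝ) (1 / 2)
      have h2 := abs_le_bracket k
      have h3 := one_le_bracket k
      rw [abs_of_pos (by norm_num : (0 : ℝ) < 1 / 2)] at h1
      linarith
    have := Real.rpow_le_rpow hk.le hle (by linarith : 0 ≤ r)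
    rw [Real.mul_rpow (by norm_num) (bracket_pos _).le] at this
    rw [Real.rpow_neg (bracket_pos _).le, mul_one_div, inv_le_iff_one_le_mul₀
      (Real.rpow_pos_of_pos (bracket_pos _) _), div_mul_eq_mul_div, le_div_iff₀
      (Real.rpow_pos_of_pos hk _), one_mul]
    exact this
  exact h2.tsum_ofReal_lt_top

/-- The number of odd positions (even indices in `Fin p`) whose frequency is the output
frequency `k₁ - k₂ + ⋯ + k_p`. -/
def resonanceCount {p : ℕ} (κ : Fin p → ℤ) : ℕ :=
  (Finset.univ.filter fun m : Fin p => Even m.val ∧ κ m = altSum κ).card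

/-- The weight `⟨x ± k²⟩` of the `l`-th factor in the variable `x = ±τ`, where the sign is that of
position `l` in the alternating sum. -/
noncomputable def modulation {p : ℕ} (l : Fin p) (k : ℤ) (x : ℝ) : ℝ :=
  bracket (x + (-1) ^ l.val * (k : ℝ) ^ 2)

theorem one_le_modulation {p : ℕ} (l : Fin p) (k : ℤ) (x : ℝ) : 1 ≤ modulation l k x :=
  one_le_bracket _

/-- The resonance function `k² - k₁² + k₂² - ⋯ - k_p²` with `k = k₁ - k₂ + ⋯ + k_p`. -/
def resonance {p : ℕ} (κ : Fin p → ℤ) : ℝ :=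
  (altSum κ : ℝ) ^ 2 - ∑ l : Fin p, (-1) ^ l.val * (κ l : ℝ) ^ 2

theorem one_le_prod_bracket {p : ℕ} (κ : Fin p → ℤ) (s : Finset (Fin p)) :
    1 ≤ ∏ i ∈ s, bracket (κ i) :=
  Finset.prod_induction _ (1 ≤ ·) (fun _ _ => one_le_mul_of_one_le_of_one_le) le_rfl
    fun _ _ => one_le_bracket _

theorem abs_le_prod_bracket {p : ℕ} (κ : Fin p → ℤ) (s : Finset (Fin p)) {l : Fin p} (hl : l ∈ s) :
    |(κ l : ℝ)| ≤ ∏ i ∈ s, bracket (κ i) :=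
  (abs_le_bracket _).trans (by
    rw [← Finset.mul_prod_erase _ _ hl]
    exact le_mul_of_one_le_right (bracket_pos _).le
      (one_le_prod_bracket κ _))

theorem abs_mul_abs_le_prod_bracket {p : ℕ} (κ : Fin p → ℤ) (s : Finset (Fin p)) {l j : Fin p}
    (hl : l ∈ s) (hj : j ∈ s.erase l) :
    |(κ l : ℝ)| * |(κ j : ℝ)| ≤ ∏ i ∈ s, bracket (κ i) := by
  rw [← Finset.mul_prod_erase _ _ hl]
  exact mul_le_mul (abs_le_bracket _) (abs_le_prod_bracket κ _ hj) (abs_nonneg _) (bracket_pos _).le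

theorem altSum_cast {p : ℕ} (κ : Fin p → ℤ) (m : Fin p) :
    (altSum κ : ℝ) = (-1) ^ m.val * (κ m : ℝ)
      + ∑ l ∈ Finset.univ.erase m, (-1) ^ l.val * (κ l : ℝ) := by
  rw [Finset.add_sum_erase Finset.univ (fun l : Fin p => (-1 : ℝ) ^ l.val * (κ l : ℝ))
    (Finset.mem_univ m)]
  simp [altSum]

theorem abs_signed_sum_le {ι : Type*} (s : Finset ι) (e : ι → ℕ) (a : ι → ℝ) :
    |∑ l ∈ s, (-1) ^ e l * a l| ≤ ∑ l ∈ s, |a l| :=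
  (Finset.abs_sum_le_sum_abs _ _).trans_eq (by simp [abs_mul, abs_pow])

/-- If position `m` is odd and its frequency differs from the output frequency, the frequency is
controlled by the resonance function and the product of the other frequencies. -/
theorem abs_le_of_ne {p : ℕ} (κ : Fin p → ℤ) (m : Fin p) (hm : Even m.val) (hne : κ m ≠ altSum κ) :
    |(κ m : ℝ)| ≤ |resonance κ|
      + p * (p + 2) * ∏ l ∈ Finset.univ.erase m, bracket (κ l) := by
  set P := ∏ l ∈ Finset.univ.erase m, bracket (κ l) with hP
  set d : ℝ := ∑ l ∈ Finset.univ.erase m, (-1) ^ l.val * (κ l : ℝ) with hd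
  set S : ℝ := ∑ l ∈ Finset.univ.erase m, (-1) ^ l.val * (κ l : ℝ) ^ 2 with hS
  have hP1 : 1 ≤ P := one_le_prod_bracket κ _
  have hcard : ((Finset.univ.erase m).card : ℝ) ≤ p := by
    exact_mod_cast (Finset.card_le_univ _).trans_eq (Fintype.card_fin p)
  have hk := altSum_cast κ m
  rw [hm.neg_one_pow, one_mul, ← hd] at hk
  have hd1 : 1 ≤ |d| := by
    have h1 : d = ((altSum κ - κ m : ℤ) : ℝ) := by push_cast; linarith
    have h2 : altSum κ - κ m ≠ 0 := fun h => hne (by omega)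
    rw [h1, ← Int.cast_abs]
    exact_mod_cast Int.one_le_abs h2
  have hdP : |d| ≤ p * P := by
    refine (abs_signed_sum_le _ _ _).trans ((Finset.sum_le_card_nsmul _ _ P fun l hl =>
      abs_le_prod_bracket κ _ hl).trans ?_)
    rw [nsmul_eq_mul]
    gcongr
  -- Either `κ l` is comparable to `d`, or some other frequency is comparable to `κ l`.
  have hl2 : ∀ l ∈ Finset.univ.erase m, |(κ l : ℝ) ^ 2| ≤ (p + 1) * P * |d| := by
    intro l hl
    have h1 : |(κ l : ℝ)| ≤ |d| + ∑ j ∈ (Finset.univ.erase m).erase l, |(κ j : ℝ)| := by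
      have h2 : (-1) ^ l.val * (κ l : ℝ)
          = d - ∑ j ∈ (Finset.univ.erase m).erase l, (-1) ^ j.val * (κ j : ℝ) := by
        rw [hd, ← Finset.add_sum_erase _ _ hl]; ring
      have h3 : |(κ l : ℝ)| = |(-1) ^ l.val * (κ l : ℝ)| := by simp [abs_mul, abs_pow]
      rw [h3, h2]
      exact (abs_sub _ _).trans (by gcongr; exact abs_signed_sum_le _ _ _)
    have h4 : ∑ j ∈ (Finset.univ.erase m).erase l, |(κ l : ℝ)| * |(κ j : ℝ)| ≤ p * P := by
      refine (Finset.sum_le_card_nsmul _ _ P fun j hj =>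
        abs_mul_abs_le_prod_bracket κ _ hl hj).trans ?_
      rw [nsmul_eq_mul]
      gcongr
      exact_mod_cast (Finset.card_le_univ _).trans_eq (Fintype.card_fin p)
    have h5 := abs_le_prod_bracket κ _ hl
    rw [← Finset.mul_sum] at h4
    have h6 := mul_le_mul_of_nonneg_left h1 (abs_nonneg (κ l : ℝ))
    have h7 : (p : ℝ) * P ≤ p * P * |d| := le_mul_of_one_le_right (by positivity) hd1
    have h8 := mul_le_mul_of_nonneg_right h5 (abs_nonneg d)
    rw [abs_pow, pow_two]
    nlinarith
  have hSb : |S| ≤ p * ((p + 1) * P * |d|) := by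
    refine (abs_signed_sum_le _ _ _).trans ((Finset.sum_le_card_nsmul _ _ _ hl2).trans ?_)
    rw [nsmul_eq_mul]
    gcongr
  have hres : 2 * d * κ m = resonance κ - d ^ 2 + S := by
    rw [resonance, ← Finset.add_sum_erase Finset.univ
      (fun l : Fin p => (-1 : ℝ) ^ l.val * (κ l : ℝ) ^ 2) (Finset.mem_univ m), ← hS,
      hm.neg_one_pow, hk]
    ring
  have h1 : 2 * |d| * |(κ m : ℝ)| ≤ |resonance κ| + |d| * |d| + |S| := by
    calc 2 * |d| * |(κ m : ℝ)| = |2 * d * κ m| := by simp [abs_mul]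
      _ ≤ |resonance κ| + |d ^ 2| + |S| := by
        rw [hres]
        exact (abs_add_le _ _).trans (by gcongr; exact abs_sub _ _)
      _ = _ := by rw [abs_pow, pow_two]
  have h2 : |resonance κ| ≤ |resonance κ| * |d| := le_mul_of_one_le_right (abs_nonneg _) hd1
  have h3 := mul_le_mul_of_nonneg_left hdP (abs_nonneg d)
  have h4 : |d| * (2 * |(κ m : ℝ)|) ≤ |d| * (|resonance κ| + p * (p + 2) * P) := by nlinarith
  have h5 := le_of_mul_le_mul_left h4 (by linarith)
  linarith [abs_nonneg (κ m : ℝ)]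

/-- At an even position the squares of the output frequency and of the frequency add up in the
resonance function, so that no nonresonance condition is needed. -/
theorem abs_le_of_odd {p : ℕ} (κ : Fin p → ℤ) (m : Fin p) (hm : ¬ Even m.val) :
    |(κ m : ℝ)| ≤ |resonance κ|
      + p * (p + 2) * ∏ l ∈ Finset.univ.erase m, bracket (κ l) := by
  set P := ∏ l ∈ Finset.univ.erase m, bracket (κ l) with hP
  set S : ℝ := ∑ l ∈ Finset.univ.erase m, (-1) ^ l.val * (κ l : ℝ) ^ 2 with hS
  have hP1 : 1 ≤ P := one_le_prod_bracket κ _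
  have hp1 : (1 : ℝ) ≤ p := by exact_mod_cast (Nat.zero_lt_of_lt m.isLt)
  have hSb : |S| ≤ p * P ^ 2 := by
    refine (abs_signed_sum_le _ _ _).trans ((Finset.sum_le_card_nsmul _ _ (P ^ 2) fun l hl => ?_).trans ?_)
    · rw [abs_pow]
      exact pow_le_pow_left₀ (abs_nonneg _) (abs_le_prod_bracket κ _ hl) 2
    · rw [nsmul_eq_mul]
      gcongr
      exact_mod_cast (Finset.card_le_univ _).trans_eq (Fintype.card_fin p)
  have hres : resonance κ = (altSum κ : ℝ) ^ 2 + (κ m : ℝ) ^ 2 - S := by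
    rw [resonance, ← Finset.add_sum_erase Finset.univ
      (fun l : Fin p => (-1 : ℝ) ^ l.val * (κ l : ℝ) ^ 2) (Finset.mem_univ m), ← hS,
      (Nat.not_even_iff_odd.1 hm).neg_one_pow]
    ring
  have h1 : (κ m : ℝ) ^ 2 ≤ |resonance κ| + p * P ^ 2 := by
    have := le_abs_self (resonance κ)
    have := le_abs_self S
    nlinarith [sq_nonneg (altSum κ : ℝ)]
  have h2 := abs_nonneg (resonance κ)
  have hpP : 1 ≤ p * P := one_le_mul_of_one_le_of_one_le hp1 hP1
  have h3 : |(κ m : ℝ)| ≤ |resonance κ| + p * P := by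
    refine abs_le_of_sq_le_sq (h1.trans ?_) (by positivity)
    nlinarith [mul_le_mul_of_nonneg_left hpP h2, mul_le_mul_of_nonneg_right hp1
      (by positivity : 0 ≤ p * P ^ 2), sq_nonneg (resonance κ)]
  nlinarith [mul_nonneg (by positivity : (0 : ℝ) ≤ p * (p + 1)) (by linarith : 0 ≤ P)]

theorem abs_le_of_resonanceCount_ne_one {p : ℕ} (κ : Fin p → ℤ) (m : Fin p)
    (h : resonanceCount κ ≠ 1) :
    |(κ m : ℝ)| ≤ |resonance κ|
      + p * (p + 2) * ∏ l ∈ Finset.univ.erase m, bracket (κ l) := by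
  by_cases hm : Even m.val
  swap
  · exact abs_le_of_odd κ m hm
  by_cases hne : κ m = altSum κ
  swap
  · exact abs_le_of_ne κ m hm hne
  -- There is a second resonant position, whose frequency equals `κ m`.
  have hmem : m ∈ Finset.univ.filter fun m : Fin p => Even m.val ∧ κ m = altSum κ := by
    simp [hm, hne]
  obtain ⟨i, hi, him⟩ := Finset.exists_mem_ne (s := Finset.univ.filter fun m : Fin p =>
    Even m.val ∧ κ m = altSum κ) (lt_of_le_of_ne (Finset.card_pos.2 ⟨m, hmem⟩) (Ne.symm h)) m
  have hii := (Finset.mem_filter.1 hi).2.2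
  have h1 := abs_le_prod_bracket κ (Finset.univ.erase m) (l := i)
    (Finset.mem_erase.2 ⟨him, Finset.mem_univ i⟩)
  rw [hii, ← hne] at h1
  have hp1 : (1 : ℝ) ≤ p := by exact_mod_cast (Nat.zero_lt_of_lt m.isLt)
  have hP : (0 : ℝ) ≤ ∏ l ∈ Finset.univ.erase m, bracket (κ l) := (abs_nonneg _).trans h1
  nlinarith [abs_nonneg (resonance κ), mul_nonneg (by nlinarith : (0 : ℝ) ≤ p * (p + 2) - 1) hP]

theorem abs_resonance_le {p : ℕ} (κ : Fin p → ℤ) (x : Fin p → ℝ) {R : ℝ}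
    (h0 : bracket (∑ l, x l + (altSum κ : ℝ) ^ 2) ≤ R) (hR : ∀ l, modulation l (κ l) (x l) ≤ R) :
    |resonance κ| ≤ (p + 1) * R := by
  have h1 : resonance κ = (∑ l, x l + (altSum κ : ℝ) ^ 2)
      - ∑ l : Fin p, (x l + (-1) ^ l.val * (κ l : ℝ) ^ 2) := by
    rw [resonance, Finset.sum_add_distrib]; ring
  rw [h1]
  refine (abs_sub _ _).trans ?_
  have h2 : |∑ l : Fin p, (x l + (-1) ^ l.val * (κ l : ℝ) ^ 2)| ≤ p * R := by
    refine (Finset.abs_sum_le_sum_abs _ _).trans ((Finset.sum_le_card_nsmul _ _ R fun l _ =>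
      (abs_le_bracket _).trans (hR l)).trans_eq ?_)
    simp
  linarith [(abs_le_bracket _).trans h0]

/-- Away from single resonances, every frequency is bounded by the product of the others times the
largest modulation. -/
theorem bracket_le_of_resonanceCount_ne_one {p : ℕ} (κ : Fin p → ℤ) (x : Fin p → ℝ) (m : Fin p)
    (h : resonanceCount κ ≠ 1) {R : ℝ}
    (h0 : bracket (∑ l, x l + (altSum κ : ℝ) ^ 2) ≤ R) (hR : ∀ l, modulation l (κ l) (x l) ≤ R) :
    bracket (κ m) ≤ (p + 1) * (p + 2) * (∏ l ∈ Finset.univ.erase m, bracket (κ l)) * R := by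
  have h1 := abs_le_of_resonanceCount_ne_one κ m h
  have h2 := abs_resonance_le κ x h0 hR
  have h3 := bracket_le_one_add_abs (κ m)
  have hR1 : 1 ≤ R := (one_le_bracket _).trans h0
  have hP1 : 1 ≤ ∏ l ∈ Finset.univ.erase m, bracket (κ l) :=
    one_le_prod_bracket κ _
  generalize (∏ l ∈ Finset.univ.erase m, bracket (κ l)) = P at *
  have h4 : R ≤ P * R := le_mul_of_one_le_left (by linarith) hP1
  have h5 : P ≤ P * R := le_mul_of_one_le_right (by linarith) hR1
  calc bracket (κ m) ≤ (p + 1) * R + (1 + p * (p + 2)) * P := by linarith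
    _ ≤ (p + 1) * (P * R) + (1 + p * (p + 2)) * (P * R) := by gcongr
    _ = _ := by ring

theorem bracket_altSum_le {p : ℕ} (κ : Fin p → ℤ) (m : Fin p) (hm : ∀ l, |κ l| ≤ |κ m|) :
    bracket (altSum κ) ≤ p * bracket (κ m) := by
  have hp1 : (1 : ℝ) ≤ p := by exact_mod_cast (Nat.zero_lt_of_lt m.isLt)
  have h1 : |(altSum κ : ℝ)| ≤ p * |(κ m : ℝ)| := by
    have : (altSum κ : ℝ) = ∑ l : Fin p, (-1) ^ l.val * (κ l : ℝ) := by simp [altSum]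
    rw [this]
    refine (abs_signed_sum_le _ _ _).trans ((Finset.sum_le_card_nsmul _ _ |(κ m : ℝ)|
      fun l _ => by exact_mod_cast hm l).trans_eq ?_)
    simp
  rw [bracket, bracket, Real.sqrt_le_left (by positivity), mul_pow, Real.sq_sqrt (by positivity)]
  have h2 := pow_le_pow_left₀ (abs_nonneg _) h1 2
  rw [sq_abs, mul_pow, sq_abs] at h2
  nlinarith

/-- The pointwise multiplier estimate: the `σ` additional derivatives on the highest frequency `κ m`
are paid for by the other frequencies and by one modulation. -/
theorem exists_multiplier_le {p : ℕ} (hp : 0 < p) {s b σ b' : ℝ} (hs : 0 ≤ s) (hσ : 0 ≤ σ)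
    (hσb : σ ≤ b) (hσb' : σ ≤ b') (κ : Fin p → ℤ) (x : Fin p → ℝ) (h : resonanceCount κ ≠ 1) :
    ∃ m j : Fin p, bracket (altSum κ) ^ (2 * (s + σ)) *
        bracket (∑ l, x l + (altSum κ : ℝ) ^ 2) ^ (2 * -b') ≤
      (p : ℝ) ^ (2 * (s + σ)) * ((p + 1) * (p + 2) : ℝ) ^ (2 * σ) *
        (bracket (κ m) ^ (2 * s) * (∏ l ∈ Finset.univ.erase m, bracket (κ l)) ^ (2 * σ) *
          modulation j (κ j) (x j) ^ (2 * b)) := by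
  have : Nonempty (Fin p) := ⟨⟨0, hp⟩⟩
  obtain ⟨m, hm⟩ := Finite.exists_max fun l => |κ l|
  obtain ⟨j, hj⟩ := Finite.exists_max fun l => modulation l (κ l) (x l)
  refine ⟨m, j, ?_⟩
  set L0 := bracket (∑ l, x l + (altSum κ : ℝ) ^ 2) with hL0
  set Lj := modulation j (κ j) (x j) with hLj
  have hL01 : 1 ≤ L0 := one_le_bracket _
  have hLj1 : 1 ≤ Lj := one_le_modulation _ _ _
  have hP1 : 1 ≤ ∏ l ∈ Finset.univ.erase m, bracket (κ l) :=
    one_le_prod_bracket κ _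
  have h1 := bracket_le_of_resonanceCount_ne_one κ x m h (le_max_left L0 Lj)
    fun l => (hj l).trans (le_max_right _ _)
  have h2 := bracket_altSum_le κ m hm
  have hN := bracket_pos (κ m)
  generalize (∏ l ∈ Finset.univ.erase m, bracket (κ l)) = P at *
  have hmax : 1 ≤ max L0 Lj := hL01.trans (le_max_left _ _)
  have hpow : max L0 Lj ^ (2 * σ) * L0 ^ (2 * -b') ≤ Lj ^ (2 * b) := by
    rcases le_total L0 Lj with hle | hle
    · rw [max_eq_right hle]
      calc Lj ^ (2 * σ) * L0 ^ (2 * -b') ≤ Lj ^ (2 * b) * 1 := by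
            gcongr
            exact Real.rpow_le_one_of_one_le_of_nonpos hL01 (by linarith)
        _ = _ := mul_one _
    · rw [max_eq_left hle, ← Real.rpow_add (by linarith)]
      exact (Real.rpow_le_one_of_one_le_of_nonpos hL01 (by linarith)).trans
        (Real.one_le_rpow hLj1 (by linarith))
  calc bracket (altSum κ) ^ (2 * (s + σ)) * L0 ^ (2 * -b')
      ≤ (p * bracket (κ m)) ^ (2 * (s + σ)) * L0 ^ (2 * -b') := by
        gcongr
        exact (bracket_pos _).le
    _ = (p : ℝ) ^ (2 * (s + σ)) * (bracket (κ m) ^ (2 * s) * bracket (κ m) ^ (2 * σ)) *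
          L0 ^ (2 * -b') := by
        rw [Real.mul_rpow (by positivity) hN.le, ← Real.rpow_add hN]; ring_nf
    _ ≤ (p : ℝ) ^ (2 * (s + σ)) * (bracket (κ m) ^ (2 * s) *
          ((p + 1) * (p + 2) * P * max L0 Lj) ^ (2 * σ)) * L0 ^ (2 * -b') := by
        gcongr
    _ = (p : ℝ) ^ (2 * (s + σ)) * ((p + 1) * (p + 2) : ℝ) ^ (2 * σ) * (bracket (κ m) ^ (2 * s) *
          P ^ (2 * σ) * (max L0 Lj ^ (2 * σ) * L0 ^ (2 * -b'))) := by
        rw [Real.mul_rpow (by positivity) (by positivity), Real.mul_rpow (by positivity)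
          (by positivity)]
        ring
    _ ≤ _ := by gcongr

/-! ### The multilinear estimate for nonnegative functions -/

/-- The weight `⟨k⟩^s ⟨x ± k²⟩^b` of the space `X^{s,b}`, with the sign of position `l`. -/
noncomputable def weight {p : ℕ} (s b : ℝ) (l : Fin p) (k : ℤ) (x : ℝ) : ℝ≥0∞ :=
  ENNReal.ofReal (bracket k ^ s * modulation l k x ^ b)

theorem measurable_modulation {p : ℕ} (l : Fin p) (k : ℤ) : Measurable (modulation l k) :=
  measurable_bracket.comp (by fun_prop)

theorem modulation_pos {p : ℕ} (l : Fin p) (k : ℤ) (x : ℝ) : 0 < modulation l k x :=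
  bracket_pos _

theorem measurable_weight {p : ℕ} (s b : ℝ) (l : Fin p) (k : ℤ) : Measurable (weight s b l k) :=
  (((measurable_modulation l k).pow_const b).const_mul _).ennreal_ofReal

theorem weight_mul_weight {p : ℕ} (s b s' b' : ℝ) (l : Fin p) (k : ℤ) (x : ℝ) :
    weight s b l k x * weight s' b' l k x = weight (s + s') (b + b') l k x := by
  have h1 := bracket_pos k
  have h2 := modulation_pos l k x
  rw [weight, weight, weight, ← ENNReal.ofReal_mul (by positivity), Real.rpow_add h1,
    Real.rpow_add h2]
  ring_nf

theorem weight_sq {p : ℕ} (s b : ℝ) (l : Fin p) (k : ℤ) (x : ℝ) :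
    weight s b l k x ^ 2 = weight (2 * s) (2 * b) l k x := by
  rw [pow_two, weight_mul_weight, two_mul, two_mul]

theorem weight_neg_mul_weight {p : ℕ} (s b : ℝ) (l : Fin p) (k : ℤ) (x : ℝ) :
    weight (-s) (-b) l k x * weight s b l k x = 1 := by
  rw [weight_mul_weight]
  simp [weight]

theorem weight_eq_mul {p : ℕ} (s b : ℝ) (l : Fin p) (k : ℤ) (x : ℝ) :
    weight s b l k x = ENNReal.ofReal (bracket k ^ s) * ENNReal.ofReal (modulation l k x ^ b) :=
  ENNReal.ofReal_mul (Real.rpow_nonneg (bracket_pos _).le _)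

theorem lintegral_modulation_rpow {p : ℕ} (l : Fin p) (k : ℤ) (r : ℝ) :
    ∫⁻ x, ENNReal.ofReal (modulation l k x ^ r) = ∫⁻ x, ENNReal.ofReal (bracket x ^ r) :=
  lintegral_add_right_eq_self (fun x => ENNReal.ofReal (bracket x ^ r)) _

theorem prod_erase_eq_prod_succAbove {n : ℕ} {M : Type*} [CommMonoid M] (j : Fin (n + 1))
    (f : Fin (n + 1) → M) : ∏ l ∈ Finset.univ.erase j, f l = ∏ i, f (j.succAbove i) := by
  have h : Finset.univ.erase j = Finset.univ.image j.succAbove := by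
    rw [Fin.image_succAbove_univ, Finset.compl_eq_univ_sdiff, Finset.sdiff_singleton_eq_erase]
  rw [h, Finset.prod_image fun _ _ _ _ h => Fin.succAbove_right_injective h]

/-- A sum over the frequencies with a prescribed alternating sum is controlled by eliminating any
one of the frequencies. -/
theorem tsum_altSum_eq_le {n : ℕ} (m : Fin (n + 1)) (k : ℤ) (S : Set (Fin (n + 1) → ℤ))
    (hS : ∀ κ ∈ S, altSum κ = k) (a : ℤ → ℝ≥0∞) :
    ∑' κ : S, ∏ i, a (κ.val (m.succAbove i)) ≤ (∑' q, a q) ^ n := by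
  have hinj : Function.Injective fun κ : S => fun i => κ.val (m.succAbove i) := by
    intro κ κ' h
    have h1 : ∀ i, κ.val (m.succAbove i) = κ'.val (m.succAbove i) := congrFun h
    have h2 := (hS _ κ.2).trans (hS _ κ'.2).symm
    simp only [altSum, Fin.sum_univ_succAbove _ m, h1, add_left_inj] at h2
    have h3 : κ.val m = κ'.val m :=
      mul_left_cancel₀ (pow_ne_zero _ (by norm_num : (-1 : ℤ) ≠ 0)) h2
    refine Subtype.ext (funext fun l => ?_)
    rcases Fin.eq_self_or_eq_succAbove m l with rfl | ⟨i, rfl⟩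
    exacts [h3, h1 i]
  refine (ENNReal.tsum_comp_le_tsum_of_injective hinj fun κ' => ∏ i, a (κ' i)).trans_eq ?_
  rw [tsum_pi_prod_ennreal (fun _ => a)]
  simp

/-- The integral of all modulation weights but one over the hyperplane of coordinate sum `τ`. -/
theorem lintegral_fiberPoint_modulation {n : ℕ} (j : Fin (n + 1)) (κ : Fin (n + 1) → ℤ) (r τ : ℝ) :
    ∫⁻ y, ∏ i, ENNReal.ofReal (modulation (j.succAbove i) (κ (j.succAbove i))
      (fiberPoint j τ y (j.succAbove i)) ^ r) = (∫⁻ x, ENNReal.ofReal (bracket x ^ r)) ^ n := by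
  simp only [fiberPoint, Fin.insertNth_apply_succAbove]
  rw [lintegral_pi_prod (fun i x => ENNReal.ofReal (modulation (j.succAbove i)
    (κ (j.succAbove i)) x ^ r)) fun i => ((measurable_modulation _ _).pow_const r).ennreal_ofReal]
  simp [lintegral_modulation_rpow]

/-- The frequencies with alternating sum `k` that enter `𝒯_N` with a nonzero coefficient. -/
def nonSingle (n : ℕ) (k : ℤ) : Set (Fin (n + 1) → ℤ) :=
  {κ | altSum κ = k ∧ resonanceCount κ ≠ 1}

/-- The weight `⟨k⟩^{2s} ⟨τ + k²⟩^{2b}` in the square of the norm of `X^{s,b}`. -/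
noncomputable def outputWeight (s b : ℝ) (k : ℤ) (τ : ℝ) : ℝ≥0∞ :=
  ENNReal.ofReal (bracket k ^ (2 * s) * bracket (τ + (k : ℝ) ^ 2) ^ (2 * b))

/-- The multiplier estimate divided by all the input weights: one spatial factor `m` and one
modulation `j` drop out. The sum over all `m` and `j` avoids choosing them measurably. -/
theorem outputWeight_mul_prod_le {n : ℕ} {s b σ b' : ℝ} (hs : 0 ≤ s) (hσ : 0 ≤ σ)
    (hσb : σ ≤ b) (hσb' : σ ≤ b') (κ : Fin (n + 1) → ℤ) (x : Fin (n + 1) → ℝ)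
    (h : resonanceCount κ ≠ 1) :
    outputWeight (s + σ) (-b') (altSum κ) (∑ l, x l) *
        ∏ l, weight (2 * -s) (2 * -b) l (κ l) (x l) ≤
      ENNReal.ofReal (((n + 1 : ℕ) : ℝ) ^ (2 * (s + σ)) *
          ((((n + 1 : ℕ) : ℝ) + 1) * (((n + 1 : ℕ) : ℝ) + 2)) ^ (2 * σ)) *
        ∑ m : Fin (n + 1), ∑ j : Fin (n + 1),
          (∏ i, ENNReal.ofReal (bracket (κ (m.succAbove i)) ^ (-(2 * (s - σ))))) *
          ∏ i, ENNReal.ofReal (modulation (j.succAbove i) (κ (j.succAbove i))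
            (x (j.succAbove i)) ^ (-(2 * b))) := by
  obtain ⟨m, j, hmj⟩ := exists_multiplier_le (Nat.succ_pos n) hs hσ hσb hσb' κ x h
  have hsum : ∀ t : Fin (n + 1) → Fin (n + 1) → ℝ≥0∞, t m j ≤ ∑ m, ∑ j, t m j := fun t =>
    (Finset.single_le_sum (f := t m) (fun _ _ => zero_le) (Finset.mem_univ j)).trans
      (Finset.single_le_sum (f := fun m => ∑ j, t m j) (fun _ _ => zero_le) (Finset.mem_univ m))
  refine le_trans ?_ (mul_le_mul_right (hsum _) _)
  have hbr : ∀ l, 0 < bracket (κ l) := fun l => bracket_pos _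
  have hmo : ∀ l, 0 < modulation l (κ l) (x l) := fun l => modulation_pos _ _ _
  have hw : ∏ l, weight (2 * -s) (2 * -b) l (κ l) (x l)
      = ENNReal.ofReal ((∏ l, bracket (κ l) ^ (2 * -s)) *
          ∏ l, modulation l (κ l) (x l) ^ (2 * -b)) := by
    rw [← Finset.prod_mul_distrib, ENNReal.ofReal_prod_of_nonneg fun l _ => by
      have := hbr l; have := hmo l; positivity]
    rfl
  have hW : 0 ≤ bracket (altSum κ) ^ (2 * (s + σ)) *
      bracket (∑ l, x l + (altSum κ : ℝ) ^ 2) ^ (2 * -b') :=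
    mul_nonneg (Real.rpow_nonneg (bracket_pos _).le _) (Real.rpow_nonneg (bracket_pos _).le _)
  rw [hw, outputWeight, ← ENNReal.ofReal_mul hW,
    ← ENNReal.ofReal_prod_of_nonneg fun i _ => (Real.rpow_pos_of_pos (hbr _) _).le,
    ← ENNReal.ofReal_prod_of_nonneg fun i _ => (Real.rpow_pos_of_pos (hmo _) _).le,
    ← ENNReal.ofReal_mul (Finset.prod_nonneg fun i _ => (Real.rpow_pos_of_pos (hbr _) _).le),
    ← ENNReal.ofReal_mul (by positivity)]
  refine ENNReal.ofReal_le_ofReal ?_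
  have hX : 0 ≤ (∏ l, bracket (κ l) ^ (2 * -s)) * ∏ l, modulation l (κ l) (x l) ^ (2 * -b) :=
    mul_nonneg (Finset.prod_nonneg fun l _ => (Real.rpow_pos_of_pos (hbr _) _).le)
      (Finset.prod_nonneg fun l _ => (Real.rpow_pos_of_pos (hmo _) _).le)
  refine (mul_le_mul_of_nonneg_right hmj hX).trans_eq ?_
  rw [← Real.finsetProd_rpow _ _ fun l _ => (hbr l).le, prod_erase_eq_prod_succAbove,
    Fin.prod_univ_succAbove (fun l => bracket (κ l) ^ (2 * -s)) m,
    Fin.prod_univ_succAbove (fun l => modulation l (κ l) (x l) ^ (2 * -b)) j]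
  have e1 : bracket (κ m) ^ (2 * s) * bracket (κ m) ^ (2 * -s) = 1 := by
    rw [← Real.rpow_add (hbr m)]; simp
  have e2 : modulation j (κ j) (x j) ^ (2 * b) * modulation j (κ j) (x j) ^ (2 * -b) = 1 := by
    rw [← Real.rpow_add (hmo j)]; simp
  have e3 : (∏ i, bracket (κ (m.succAbove i)) ^ (2 * σ)) *
      ∏ i, bracket (κ (m.succAbove i)) ^ (2 * -s)
      = ∏ i, bracket (κ (m.succAbove i)) ^ (-(2 * (s - σ))) := by
    rw [← Finset.prod_mul_distrib]
    refine Finset.prod_congr rfl fun i _ => ?_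
    rw [← Real.rpow_add (hbr _)]
    ring_nf
  rw [← e3, show -(2 * b) = 2 * -b by ring]
  have alg : ∀ C a a' u v q q' w : ℝ, a * a' = 1 → q * q' = 1 →
      C * (a * u * q) * (a' * v * (q' * w)) = C * (u * v * w) := fun C a a' u v q q' w h h' => by
    linear_combination C * u * v * w * (q * q' * h + h')
  exact alg _ _ _ _ _ _ _ _ e1 e2

/-- A constant for the squared form of the multilinear estimate: `p²` choices of the eliminated
frequency and of the eliminated time variable, each contributing a product of convergent sums and
integrals. -/
noncomputable def smoothingConst (n : ℕ) (s b σ : ℝ) : ℝ≥0∞ :=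
  ENNReal.ofReal (((n + 1 : ℕ) : ℝ) ^ (2 * (s + σ)) *
      ((((n + 1 : ℕ) : ℝ) + 1) * (((n + 1 : ℕ) : ℝ) + 2)) ^ (2 * σ)) *
    ∑ _m : Fin (n + 1), ∑ _j : Fin (n + 1),
      (∑' q : ℤ, ENNReal.ofReal (bracket q ^ (-(2 * (s - σ))))) ^ n *
      (∫⁻ x, ENNReal.ofReal (bracket x ^ (-(2 * b)))) ^ n

theorem smoothingConst_lt_top {n : ℕ} {s b σ : ℝ} (hs : 1 < 2 * (s - σ)) (hb : 1 < 2 * b) :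
    smoothingConst n s b σ < ∞ :=
  ENNReal.mul_lt_top ENNReal.ofReal_lt_top <| ENNReal.sum_lt_top.2 fun _ _ =>
    ENNReal.sum_lt_top.2 fun _ _ => ENNReal.mul_lt_top
      (ENNReal.pow_lt_top (tsum_bracket_rpow_lt_top hs))
      (ENNReal.pow_lt_top (lintegral_bracket_rpow_lt_top hb))

/-- The bound, uniform in `(k, τ)`, of the fibre integral that the Cauchy-Schwarz inequality produces
in the multilinear estimate. The integral eliminates the time variable `0`; for each term it is
replaced by the one eliminating `j`, which agrees for almost every `τ`. -/
theorem outputWeight_mul_tsum_le {n : ℕ} {s b σ b' : ℝ} (hs : 0 ≤ s) (hσ : 0 ≤ σ)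
    (hσb : σ ≤ b) (hσb' : σ ≤ b') (k : ℤ) :
    ∀ᵐ τ : ℝ, outputWeight (s + σ) (-b') k τ * ∑' κ : nonSingle n k, ∫⁻ y,
      (∏ l, weight (-s) (-b) l (κ.val l) (fiberPoint 0 τ y l)) ^ 2 ≤ smoothingConst n s b σ := by
  have hmeas : ∀ (κ : Fin (n + 1) → ℤ) (j : Fin (n + 1)), Measurable fun x : Fin (n + 1) → ℝ =>
      ∏ i, ENNReal.ofReal (modulation (j.succAbove i) (κ (j.succAbove i))
        (x (j.succAbove i)) ^ (-(2 * b))) := fun κ j =>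
    Finset.measurable_prod _ fun i _ =>
      (((measurable_modulation _ _).comp (measurable_pi_apply _)).pow_const _).ennreal_ofReal
  have hae : ∀ᵐ τ : ℝ, ∀ (κ : Fin (n + 1) → ℤ) (j : Fin (n + 1)), ∫⁻ y,
      ∏ i, ENNReal.ofReal (modulation (j.succAbove i) (κ (j.succAbove i))
        (fiberPoint 0 τ y (j.succAbove i)) ^ (-(2 * b)))
      = (∫⁻ x, ENNReal.ofReal (bracket x ^ (-(2 * b)))) ^ n := by
    refine ae_all_iff.2 fun κ => ae_all_iff.2 fun j => ?_
    filter_upwards [lintegral_fiberPoint_ae_eq 0 j (hmeas κ j)] with τ hτ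
    exact hτ.trans (lintegral_fiberPoint_modulation j κ _ τ)
  filter_upwards [hae] with τ hτ
  set A := ENNReal.ofReal (((n + 1 : ℕ) : ℝ) ^ (2 * (s + σ)) *
      ((((n + 1 : ℕ) : ℝ) + 1) * (((n + 1 : ℕ) : ℝ) + 2)) ^ (2 * σ)) with hA
  have hm0 : ∀ (κ : Fin (n + 1) → ℤ) (j : Fin (n + 1)), Measurable fun y : Fin n → ℝ =>
      ∏ i, ENNReal.ofReal (modulation (j.succAbove i) (κ (j.succAbove i))
        (fiberPoint 0 τ y (j.succAbove i)) ^ (-(2 * b))) := fun κ j =>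
    (hmeas κ j).comp (measurable_fiberPoint 0 τ)
  have h1 : ∀ κ : nonSingle n k, outputWeight (s + σ) (-b') k τ * ∫⁻ y,
      (∏ l, weight (-s) (-b) l (κ.val l) (fiberPoint 0 τ y l)) ^ 2 ≤
      A * ∑ m : Fin (n + 1), ∑ _j : Fin (n + 1),
        (∏ i, ENNReal.ofReal (bracket (κ.val (m.succAbove i)) ^ (-(2 * (s - σ))))) *
          (∫⁻ x, ENNReal.ofReal (bracket x ^ (-(2 * b)))) ^ n := by
    rintro ⟨κ, hκ, hκ1⟩
    rw [← lintegral_const_mul' _ _ (by simp [outputWeight])]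
    calc _ ≤ ∫⁻ y, A * ∑ m : Fin (n + 1), ∑ j : Fin (n + 1),
          (∏ i, ENNReal.ofReal (bracket (κ (m.succAbove i)) ^ (-(2 * (s - σ))))) *
          ∏ i, ENNReal.ofReal (modulation (j.succAbove i) (κ (j.succAbove i))
            (fiberPoint 0 τ y (j.succAbove i)) ^ (-(2 * b))) := by
          refine lintegral_mono fun y => ?_
          have := outputWeight_mul_prod_le hs hσ hσb hσb' κ (fiberPoint 0 τ y) hκ1
          rw [sum_fiberPoint, hκ] at this
          simpa only [← Finset.prod_pow, weight_sq] using this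
      _ = _ := by
          rw [lintegral_const_mul' _ _ ENNReal.ofReal_ne_top, lintegral_finsetSum _ fun m _ =>
            Finset.measurable_sum _ fun j _ => (hm0 κ j).const_mul _]
          simp_rw [lintegral_finsetSum _ fun j _ => (hm0 κ j).const_mul _,
            lintegral_const_mul _ (hm0 κ _), hτ]
          rw [hA]
  rw [← ENNReal.tsum_mul_left]
  refine (ENNReal.tsum_le_tsum h1).trans ?_
  rw [ENNReal.tsum_mul_left, smoothingConst, ← hA,
    Summable.tsum_finsetSum fun _ _ => ENNReal.summable]
  gcongr with m
  rw [Summable.tsum_finsetSum fun _ _ => ENNReal.summable]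
  gcongr with j
  rw [ENNReal.tsum_mul_right]
  gcongr
  exact tsum_altSum_eq_le m k _ (fun κ hκ => hκ.1) fun q =>
    ENNReal.ofReal (bracket q ^ (-(2 * (s - σ))))

/-- The multilinear estimate for nonnegative functions, in the signed time variables. -/
theorem tsum_lintegral_outputWeight_le {n : ℕ} {s b σ b' : ℝ} (hs : 0 ≤ s) (hσ : 0 ≤ σ)
    (hσb : σ ≤ b) (hσb' : σ ≤ b') (H : Fin (n + 1) → ℤ → ℝ → ℝ≥0∞)
    (hH : ∀ l k, Measurable (H l k)) :
    ∑' k : ℤ, ∫⁻ τ, outputWeight (s + σ) (-b') k τ *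
        (∑' κ : nonSingle n k, ∫⁻ y, ∏ l, H l (κ.val l) (fiberPoint 0 τ y l)) ^ 2 ≤
      smoothingConst n s b σ *
        ∏ l, ∑' k, ∫⁻ x, weight (2 * s) (2 * b) l k x * H l k x ^ 2 := by
  have hwm : ∀ (s b : ℝ) (κ : Fin (n + 1) → ℤ), Measurable fun x : Fin (n + 1) → ℝ =>
      ∏ l, weight s b l (κ l) (x l) := fun s b κ =>
    Finset.measurable_prod _ fun l _ => (measurable_weight _ _ _ _).comp (measurable_pi_apply l)
  have hHm : ∀ (κ : Fin (n + 1) → ℤ), Measurable fun x : Fin (n + 1) → ℝ =>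
      ∏ l, H l (κ l) (x l) := fun κ =>
    Finset.measurable_prod _ fun l _ => (hH _ _).comp (measurable_pi_apply l)
  have hsq : ∀ (κ : Fin (n + 1) → ℤ), Measurable fun x : Fin (n + 1) → ℝ =>
      ((∏ l, weight s b l (κ l) (x l)) * ∏ l, H l (κ l) (x l)) ^ 2 := fun κ =>
    ((hwm s b κ).mul (hHm κ)).pow_const 2
  have h1 : ∀ k : ℤ, ∫⁻ τ, outputWeight (s + σ) (-b') k τ *
        (∑' κ : nonSingle n k, ∫⁻ y, ∏ l, H l (κ.val l) (fiberPoint 0 τ y l)) ^ 2 ≤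
      smoothingConst n s b σ * ∑' κ : altSum (p := n + 1) ⁻¹' {k}, ∫⁻ x : Fin (n + 1) → ℝ,
        ((∏ l, weight s b l (κ.val l) (x l)) * ∏ l, H l (κ.val l) (x l)) ^ 2 := by
    intro k
    have hcs : ∀ τ : ℝ,
        (∑' κ : nonSingle n k, ∫⁻ y, ∏ l, H l (κ.val l) (fiberPoint 0 τ y l)) ^ 2 ≤
        (∑' κ : nonSingle n k, ∫⁻ y,
          (∏ l, weight (-s) (-b) l (κ.val l) (fiberPoint 0 τ y l)) ^ 2) *
        ∑' κ : nonSingle n k, ∫⁻ y, ((∏ l, weight s b l (κ.val l) (fiberPoint 0 τ y l)) *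
          ∏ l, H l (κ.val l) (fiberPoint 0 τ y l)) ^ 2 := by
      intro τ
      refine le_trans (le_of_eq ?_) (tsum_lintegral_mul_sq_le volume
        (fun κ : nonSingle n k => (hwm (-s) (-b) κ.val).comp (measurable_fiberPoint 0 τ))
        (fun κ : nonSingle n k => ((hwm s b κ.val).mul (hHm κ.val)).comp
          (measurable_fiberPoint 0 τ)))
      congr 1
      refine tsum_congr fun κ => lintegral_congr fun y => ?_
      rw [← mul_assoc, ← Finset.prod_mul_distrib]
      simp [weight_neg_mul_weight]
    calc _ ≤ ∫⁻ τ, smoothingConst n s b σ * ∑' κ : nonSingle n k, ∫⁻ y,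
          ((∏ l, weight s b l (κ.val l) (fiberPoint 0 τ y l)) *
          ∏ l, H l (κ.val l) (fiberPoint 0 τ y l)) ^ 2 := by
          refine lintegral_mono_ae ?_
          filter_upwards [outputWeight_mul_tsum_le (n := n) hs hσ hσb hσb' k] with τ hτ
          refine (mul_le_mul_right (hcs τ) _).trans ?_
          rw [← mul_assoc]
          exact mul_le_mul_left hτ _
      _ = smoothingConst n s b σ * ∑' κ : nonSingle n k, ∫⁻ x : Fin (n + 1) → ℝ,
          ((∏ l, weight s b l (κ.val l) (x l)) * ∏ l, H l (κ.val l) (x l)) ^ 2 := by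
          rw [lintegral_const_mul _ (Measurable.tsum fun κ : nonSingle n k =>
              measurable_lintegral_fiberPoint 0 (hsq κ.val)),
            lintegral_tsum fun κ : nonSingle n k =>
              (measurable_lintegral_fiberPoint 0 (hsq κ.val)).aemeasurable]
          simp_rw [fun κ : nonSingle n k => lintegral_fiberPoint 0 (hsq κ.val)]
      _ ≤ _ := by
          refine mul_le_mul_right ?_ _
          have hsub : nonSingle n k ⊆ altSum ⁻¹' {k} := fun κ hκ => And.left hκ
          exact ENNReal.tsum_mono_subtype (fun κ : Fin (n + 1) → ℤ => ∫⁻ x : Fin (n + 1) → ℝ,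
            ((∏ l, weight s b l (κ l) (x l)) * ∏ l, H l (κ l) (x l)) ^ 2) hsub
  refine (ENNReal.tsum_le_tsum h1).trans_eq ?_
  rw [ENNReal.tsum_mul_left, ENNReal.tsum_fiberwise
    (fun κ : Fin (n + 1) → ℤ => ∫⁻ x : Fin (n + 1) → ℝ,
    ((∏ l, weight s b l (κ l) (x l)) * ∏ l, H l (κ l) (x l)) ^ 2) altSum,
    ← tsum_pi_prod_ennreal]
  congr 1
  refine tsum_congr fun κ => ?_
  rw [← lintegral_pi_prod (fun l x => weight (2 * s) (2 * b) l (κ l) x * H l (κ l) x ^ 2)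
    fun l => (measurable_weight _ _ _ _).mul ((hH _ _).pow_const 2)]
  refine lintegral_congr fun x => ?_
  rw [← Finset.prod_mul_distrib, ← Finset.prod_pow]
  simp_rw [mul_pow, weight_sq]

/-- `X^{s,b}` with `s, b > 1/2` embeds into the functions with integrable space-time Fourier
transform. -/
theorem tsum_lintegral_lt_top {p : ℕ} {s b : ℝ} (hs : 1 < 2 * s) (hb : 1 < 2 * b) (l : Fin p)
    (H : ℤ → ℝ → ℝ≥0∞) (hH : ∀ k, Measurable (H k))
    (hfin : ∑' k, ∫⁻ x, weight (2 * s) (2 * b) l k x * H k x ^ 2 < ∞) :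
    ∑' k, ∫⁻ x, H k x < ∞ := by
  have h := tsum_lintegral_mul_sq_le volume (fun k => measurable_weight (-s) (-b) l k)
    (fun k => (measurable_weight s b l k).mul (hH k))
  simp only [Pi.mul_apply, ← mul_assoc, weight_neg_mul_weight, one_mul, mul_pow, weight_sq] at h
  have h1 : ∑' k, ∫⁻ x, weight (2 * -s) (2 * -b) l k x < ∞ := by
    simp_rw [weight_eq_mul, lintegral_const_mul' _ _ ENNReal.ofReal_ne_top,
      lintegral_modulation_rpow, ENNReal.tsum_mul_right, mul_neg]
    exact ENNReal.mul_lt_top (tsum_bracket_rpow_lt_top hs) (lintegral_bracket_rpow_lt_top hb)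
  have h2 := h.trans_lt (ENNReal.mul_lt_top h1 hfin)
  exact lt_top_iff_ne_top.2 fun h3 => by simp [h3] at h2

/-! ### Fourier series at a fixed time -/

/-- The function `(2π)^{-1/2} ∑ᵢ aᵢ e^{i eᵢ x}` on the torus. -/
noncomputable def fourierSum {ι : Type*} (a : ι → ℂ) (e : ι → ℤ) (x : Torus) : ℂ :=
  (Real.sqrt (2 * Real.pi) : ℂ)⁻¹ * ∑' i, a i * fourier (e i) x

theorem norm_fourier_apply (k : ℤ) (x : Torus) : ‖(fourier k x : ℂ)‖ = 1 := by
  rw [fourier_apply]; exact Circle.norm_coe _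

theorem sqrt_two_pi_ne_zero : (Real.sqrt (2 * Real.pi) : ℂ) ≠ 0 :=
  Complex.ofReal_ne_zero.2 (Real.sqrt_pos.2 Real.two_pi_pos).ne'

theorem sqrt_two_pi_mul_self :
    (Real.sqrt (2 * Real.pi) : ℂ) * (Real.sqrt (2 * Real.pi) : ℂ) = 2 * Real.pi := by
  rw [← Complex.ofReal_mul, Real.mul_self_sqrt Real.two_pi_pos.le]
  push_cast
  rfl

theorem summable_mul_fourier {ι : Type*} {a : ι → ℂ} (ha : Summable fun i => ‖a i‖) (e : ι → ℤ)
    (x : Torus) : Summable fun i => ‖a i * fourier (e i) x‖ := by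
  simpa only [norm_mul, norm_fourier_apply, mul_one] using ha

theorem integral_fourier_mul_fourier (j k : ℤ) :
    ∫ x : Torus, fourier j x * fourier (-k) x = if j = k then (2 * Real.pi : ℂ) else 0 := by
  have h1 := congrFun (fourierCoeff_fourier (T := 2 * Real.pi) j) k
  rw [fourierCoeff, AddCircle.integral_haarAddCircle, Pi.single_apply] at h1
  simp only [smul_eq_mul, Complex.real_smul] at h1
  have h2 : ((2 * Real.pi : ℝ) : ℂ) ≠ 0 := Complex.ofReal_ne_zero.2 Real.two_pi_pos.ne'
  simp_rw [mul_comm (fourier j _)]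
  rw [Complex.ofReal_inv, inv_mul_eq_iff_eq_mul₀ h2] at h1
  rw [h1]
  by_cases h : j = k
  · simp [h]
  · simp [h, Ne.symm h]

theorem spatialCoeff_fourierSum {ι : Type*} [Countable ι] {a : ι → ℂ}
    (ha : Summable fun i => ‖a i‖) (e : ι → ℤ) (k : ℤ) :
    spatialCoeff (fourierSum a e) k = ∑' i, if e i = k then a i else 0 := by
  have hint : ∀ i, Integrable fun x : Torus => a i * (fourier (e i) x * fourier (-k) x) := fun i =>
    Continuous.integrable_of_hasCompactSupport (by fun_prop)
      (HasCompactSupport.of_compactSpace _)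
  have h := integral_tsum_of_summable_integral_norm hint (by
    simp only [norm_mul, norm_fourier_apply, mul_one, integral_const]
    exact ha.const_smul _)
  simp_rw [integral_const_mul, integral_fourier_mul_fourier] at h
  simp_rw [spatialCoeff, fourierSum, mul_assoc, ← tsum_mul_right, mul_assoc]
  rw [integral_const_mul, ← h, ← mul_assoc, ← mul_inv, sqrt_two_pi_mul_self, ← tsum_mul_left]
  refine tsum_congr fun i => ?_
  have h2 : (2 * Real.pi : ℂ) ≠ 0 := by
    rw [← sqrt_two_pi_mul_self]; exact mul_ne_zero sqrt_two_pi_ne_zero sqrt_two_pi_ne_zero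
  split_ifs
  · field_simp
  · simp

theorem continuous_fourierSum {ι X : Type*} [TopologicalSpace X] {A : X → ι → ℂ} {u : ι → ℝ}
    (hA : ∀ i, Continuous fun t => A t i) (hu : Summable u) (hAu : ∀ t i, ‖A t i‖ ≤ u i)
    (e : ι → ℤ) : Continuous fun z : X × Torus => fourierSum (A z.1) e z.2 := by
  refine continuous_const.mul (continuous_tsum (fun i => ?_) hu fun i z => ?_)
  · exact ((hA i).comp continuous_fst).mul ((map_continuous _).comp continuous_snd)
  · rw [norm_mul, norm_fourier_apply, mul_one]
    exact hAu _ _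

theorem continuous_fourierSum_right {ι : Type*} {a : ι → ℂ} (ha : Summable fun i => ‖a i‖)
    (e : ι → ℤ) : Continuous (fourierSum a e) := by
  unfold fourierSum
  exact continuous_const.mul (continuous_tsum (fun i => continuous_const.mul (map_continuous _)) ha
    fun i x => by rw [norm_mul, norm_fourier_apply, mul_one])

theorem spatialCoeff_congr_ae {v w : Torus → ℂ} (h : v =ᵐ[volume] w) (k : ℤ) :
    spatialCoeff v k = spatialCoeff w k := by
  rw [spatialCoeff, spatialCoeff]
  congr 1
  refine integral_congr_ae ?_
  filter_upwards [h] with x hx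
  rw [hx]

theorem integrable_mul_fourier {v : Torus → ℂ} (hv : Integrable v) (k : ℤ) :
    Integrable fun x => v x * fourier k x :=
  hv.mul_bdd (map_continuous _).aestronglyMeasurable
    (Filter.Eventually.of_forall fun x => (norm_fourier_apply k x).le)

/-- An integrable function on the torus with summable Fourier coefficients is the sum of its
Fourier series almost everywhere. -/
theorem ae_eq_fourierSum {v : Torus → ℂ} (hv : Integrable v) {g : ℤ → ℂ}
    (hg : ∀ k, spatialCoeff v k = g k) (hsum : Summable fun k => ‖g k‖) :
    v =ᵐ[volume] fourierSum g id := by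
  have hi : Integrable (fourierSum g id) :=
    (continuous_fourierSum_right hsum id).integrable_of_hasCompactSupport
      (HasCompactSupport.of_compactSpace _)
  have h0 : (fun x => v x - fourierSum g id x) =ᵐ[volume] 0 := by
    refine ae_eq_zero_of_spatialCoeff_eq_zero (hv.sub hi) fun k => ?_
    have h1 := spatialCoeff_fourierSum hsum id k
    simp only [id, tsum_ite_eq] at h1
    rw [← hg k] at h1
    simp only [spatialCoeff, sub_mul] at h1 ⊢
    rw [integral_sub (integrable_mul_fourier hv _) (integrable_mul_fourier hi _), mul_sub, h1,
      sub_self]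
  filter_upwards [h0] with x hx
  exact sub_eq_zero.1 hx

section conjAt
variable {p : ℕ} (l : Fin p)

theorem conjAt_mul (z w : ℂ) : conjAt l (z * w) = conjAt l z * conjAt l w := by
  unfold conjAt; split_ifs <;> simp

theorem norm_conjAt (z : ℂ) : ‖conjAt l z‖ = ‖z‖ := by
  unfold conjAt; split_ifs <;> simp

theorem continuous_conjAt : Continuous (conjAt l) := by
  unfold conjAt; split_ifs <;> fun_prop

theorem conjAt_ofReal (r : ℝ) : conjAt l (r : ℂ) = r := by
  unfold conjAt; split_ifs <;> simp

theorem conjAt_tsum {ι : Type*} (f : ι → ℂ) : conjAt l (∑' i, f i) = ∑' i, conjAt l (f i) := by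
  unfold conjAt; split_ifs
  · rfl
  · exact Complex.conj_tsum _

theorem conjAt_fourier (k : ℤ) (x : Torus) :
    conjAt l (fourier k x) = fourier ((-1) ^ l.val * k) x := by
  unfold conjAt; split_ifs with h
  · rw [h.neg_one_pow, one_mul]
  · rw [(Nat.not_even_iff_odd.1 h).neg_one_pow, neg_one_mul, fourier_neg]

end conjAt

theorem prod_fourier {ι : Type*} (s : Finset ι) (q : ι → ℤ) (x : Torus) :
    ∏ l ∈ s, (fourier (q l) x : ℂ) = fourier (∑ l ∈ s, q l) x := by
  classical
  induction s using Finset.induction_on with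
  | empty => simp
  | insert i s hi ih => rw [Finset.prod_insert hi, Finset.sum_insert hi, fourier_add, ih]

/-- The normalizing factor `(2π)^{-n/2}` of a product of `n + 1` functions. -/
noncomputable def normFactor (n : ℕ) : ℂ := ((Real.sqrt (2 * Real.pi) : ℂ)⁻¹) ^ n

theorem rpow_eq_normFactor (n : ℕ) :
    (((2 * Real.pi) ^ (-((((n + 1 : ℕ) : ℝ) - 1) / 2)) : ℝ) : ℂ) = normFactor n := by
  rw [normFactor, ← Complex.ofReal_inv, ← Complex.ofReal_pow, Real.sqrt_eq_rpow,
    ← Real.rpow_neg Real.two_pi_pos.le, ← Real.rpow_natCast, ← Real.rpow_mul Real.two_pi_pos.le]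
  congr 2
  push_cast
  ring

section fixedTime
variable {n : ℕ} {g : Fin (n + 1) → ℤ → ℂ}

theorem summable_prod_conjAt (hg : ∀ l, Summable fun k => ‖g l k‖) :
    Summable fun κ : Fin (n + 1) → ℤ => ‖∏ l, conjAt l (g l (κ l))‖ :=
  summable_pi_prod_norm (fun l k => conjAt l (g l k)) fun l => by
    simpa only [norm_conjAt] using hg l

theorem opT_eq_fourierSum {u : Fin (n + 1) → ℝ → Torus → ℂ} {t : ℝ} {x : Torus}
    (hg : ∀ l, Summable fun k => ‖g l k‖) (hx : ∀ l, u l t x = fourierSum (g l) id x) :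
    opT u t x = fourierSum
      (fun κ : Fin (n + 1) → ℤ => normFactor n * ∏ l, conjAt l (g l (κ l))) altSum x := by
  have h1 : ∀ l, conjAt l (u l t x) = (Real.sqrt (2 * Real.pi) : ℂ)⁻¹ *
      ∑' k, conjAt l (g l k) * fourier ((-1) ^ l.val * k) x := fun l => by
    rw [hx, fourierSum, conjAt_mul, ← Complex.ofReal_inv, conjAt_ofReal, conjAt_tsum]
    simp_rw [conjAt_mul, id, conjAt_fourier]
  rw [opT]
  simp_rw [h1]
  rw [Finset.prod_mul_distrib, Finset.prod_const, Finset.card_univ, Fintype.card_fin,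
    ← tsum_pi_prod (fun l k => conjAt l (g l k) * fourier ((-1) ^ l.val * k) x) fun l => by
      simpa only [norm_mul, norm_fourier_apply, mul_one, norm_conjAt] using hg l,
    fourierSum, pow_succ', mul_assoc, ← tsum_mul_left]
  congr 1
  refine tsum_congr fun κ => ?_
  rw [Finset.prod_mul_distrib, prod_fourier, normFactor, altSum, mul_assoc]

/-- Collecting the terms of `𝒯_R` by frequencies: each `κ` is counted once per resonant position. -/
theorem sum_tsum_eq_tsum_resonanceCount (hg : ∀ l, Summable fun k => ‖g l k‖) (k : ℤ) :
    ∑ m : Fin (n + 1) with Even m.val,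
      ∑' κ : {κ : Fin (n + 1) → ℤ // altSum κ = k ∧ κ m = k}, ∏ l, conjAt l (g l (κ.val l))
    = ∑' κ : altSum (p := n + 1) ⁻¹' {k},
        (resonanceCount κ.val : ℂ) * ∏ l, conjAt l (g l (κ.val l)) := by
  have hs := summable_prod_conjAt hg
  have h1 : ∀ m : Fin (n + 1),
      ∑' κ : {κ : Fin (n + 1) → ℤ // altSum κ = k ∧ κ m = k}, ∏ l, conjAt l (g l (κ.val l))
      = ∑' κ : Fin (n + 1) → ℤ, {κ | altSum κ = k ∧ κ m = k}.indicator
          (fun κ => ∏ l, conjAt l (g l (κ l))) κ := fun m =>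
    tsum_subtype {κ : Fin (n + 1) → ℤ | altSum κ = k ∧ κ m = k}
      (fun κ => ∏ l, conjAt l (g l (κ l)))
  have h2 := tsum_subtype (altSum (p := n + 1) ⁻¹' {k})
    fun κ => (resonanceCount κ : ℂ) * ∏ l, conjAt l (g l (κ l))
  rw [h2]
  simp_rw [h1]
  rw [← Summable.tsum_finsetSum fun m _ => (hs.of_norm).indicator _]
  refine tsum_congr fun κ => ?_
  by_cases hκ : altSum κ = k
  · rw [indicator_of_mem (show κ ∈ altSum ⁻¹' {k} from hκ)]
    simp only [indicator_apply, mem_ofPred_eq, hκ, true_and, resonanceCount]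
    rw [← Finset.sum_filter, Finset.filter_filter, Finset.sum_const, nsmul_eq_mul]
  · rw [indicator_of_notMem (show κ ∉ altSum ⁻¹' {k} from hκ)]
    simp [hκ]

theorem summable_resonanceCount_mul (hg : ∀ l, Summable fun k => ‖g l k‖) :
    Summable fun κ : Fin (n + 1) → ℤ =>
      ‖(resonanceCount κ : ℂ) * ∏ l, conjAt l (g l (κ l))‖ := by
  refine Summable.of_nonneg_of_le (fun _ => norm_nonneg _) (fun κ => ?_)
    ((summable_prod_conjAt hg).mul_left ((n + 1 : ℕ) : ℝ))
  rw [norm_mul, Complex.norm_natCast]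
  gcongr
  exact (Finset.card_le_univ _).trans_eq (Fintype.card_fin _)

theorem opTR_eq_fourierSum {u : Fin (n + 1) → ℝ → Torus → ℂ} {t : ℝ} (x : Torus)
    (hg : ∀ l, Summable fun k => ‖g l k‖) (hu : ∀ l k, spatialCoeff (u l t) k = g l k) :
    opTR u t x = fourierSum (fun κ : Fin (n + 1) → ℤ =>
      normFactor n * ((resonanceCount κ : ℂ) * ∏ l, conjAt l (g l (κ l)))) altSum x := by
  have hs : Summable fun κ : Fin (n + 1) → ℤ =>
      normFactor n * ((resonanceCount κ : ℂ) * ∏ l, conjAt l (g l (κ l))) * fourier (altSum κ) x :=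
    (summable_mul_fourier (a := fun κ : Fin (n + 1) → ℤ => normFactor n * ((resonanceCount κ : ℂ) *
      ∏ l, conjAt l (g l (κ l)))) (by
        simpa only [norm_mul (normFactor n)] using
          (summable_resonanceCount_mul hg).mul_left ‖normFactor n‖) altSum x).of_norm
  rw [opTR, fourierSum, ← (hs.hasSum.tsum_fiberwise altSum).tsum_eq]
  congr 1
  refine tsum_congr fun k => ?_
  have h1 : ∀ κ : altSum (p := n + 1) ⁻¹' {k}, altSum κ.val = k := fun κ => κ.2
  simp_rw [coeffTR, hu, sum_tsum_eq_tsum_resonanceCount hg k, rpow_eq_normFactor, h1,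
    tsum_mul_right, tsum_mul_left]

/-- The coefficient of the frequencies `κ` in `𝒯_N`, where `g l` are the Fourier coefficients of the
`l`-th factor. -/
noncomputable def coeffTN (g : Fin (n + 1) → ℤ → ℂ) (κ : Fin (n + 1) → ℤ) : ℂ :=
  normFactor n * ((1 - (resonanceCount κ : ℂ)) * ∏ l, conjAt l (g l (κ l)))

theorem norm_one_sub_resonanceCount_le (κ : Fin (n + 1) → ℤ) :
    ‖1 - (resonanceCount κ : ℂ)‖ ≤ (n + 1 : ℕ) := by
  have h : (resonanceCount κ : ℝ) ≤ (n + 1 : ℕ) := by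
    exact_mod_cast (Finset.card_le_univ _).trans_eq (Fintype.card_fin _)
  have h1 : (1 : ℂ) - (resonanceCount κ : ℂ) = ((1 - (resonanceCount κ : ℝ) : ℝ) : ℂ) := by
    push_cast; rfl
  have h2 : (0 : ℝ) ≤ resonanceCount κ := Nat.cast_nonneg _
  rw [h1, Complex.norm_real, Real.norm_eq_abs, abs_le]
  push_cast at h ⊢
  constructor <;> linarith [(Nat.cast_nonneg n : (0 : ℝ) ≤ n)]

theorem norm_normFactor_le (n : ℕ) : ‖normFactor n‖ ≤ 1 := by
  rw [normFactor, norm_pow, norm_inv, Complex.norm_real, Real.norm_eq_abs,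
    abs_of_nonneg (Real.sqrt_nonneg _)]
  refine pow_le_one₀ (inv_nonneg.2 (Real.sqrt_nonneg _)) (inv_le_one_of_one_le₀ ?_)
  rw [Real.one_le_sqrt]
  linarith [Real.pi_gt_three]

theorem norm_coeffTN_le (κ : Fin (n + 1) → ℤ) :
    ‖coeffTN g κ‖ ≤ (n + 1 : ℕ) * ∏ l, ‖g l (κ l)‖ := by
  rw [coeffTN, norm_mul, norm_mul, norm_prod]
  simp_rw [norm_conjAt]
  refine (mul_le_of_le_one_left (by positivity) (norm_normFactor_le n)).trans ?_
  gcongr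
  exact norm_one_sub_resonanceCount_le κ

theorem summable_coeffTN (hg : ∀ l, Summable fun k => ‖g l k‖) :
    Summable fun κ => ‖coeffTN g κ‖ := by
  refine Summable.of_nonneg_of_le (fun _ => norm_nonneg _) norm_coeffTN_le (Summable.mul_left _ ?_)
  simpa only [norm_prod] using summable_pi_prod_norm g hg

/-- The hypothesis on the values of `u l t` is only needed at the point `x`, since `𝒯_R` depends on
`u` through Fourier coefficients alone. -/
theorem opTN_eq_fourierSum {u : Fin (n + 1) → ℝ → Torus → ℂ} {t : ℝ} {x : Torus}
    (hg : ∀ l, Summable fun k => ‖g l k‖) (hu : ∀ l k, spatialCoeff (u l t) k = g l k)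
    (hx : ∀ l, u l t x = fourierSum (g l) id x) :
    opTN u t x = fourierSum (coeffTN g) altSum x := by
  have h1 := (summable_mul_fourier (a := fun κ : Fin (n + 1) → ℤ => normFactor n *
      ∏ l, conjAt l (g l (κ l))) (by simpa only [norm_mul (normFactor n)] using
        (summable_prod_conjAt hg).mul_left ‖normFactor n‖) altSum x).of_norm
  have h2 := (summable_mul_fourier (a := fun κ : Fin (n + 1) → ℤ => normFactor n *
      ((resonanceCount κ : ℂ) * ∏ l, conjAt l (g l (κ l))))
      (by simpa only [norm_mul (normFactor n)] using
        (summable_resonanceCount_mul hg).mul_left ‖normFactor n‖) altSum x).of_norm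
  rw [opTN, opT_eq_fourierSum hg hx, opTR_eq_fourierSum x hg hu, fourierSum, fourierSum, fourierSum,
    ← mul_sub, ← h1.tsum_sub h2]
  congr 1
  refine tsum_congr fun κ => ?_
  rw [coeffTN]
  ring

theorem spatialCoeff_opTN {u : Fin (n + 1) → ℝ → Torus → ℂ} {t : ℝ}
    (hint : ∀ l, Integrable (u l t)) (hg : ∀ l, Summable fun k => ‖g l k‖)
    (hu : ∀ l k, spatialCoeff (u l t) k = g l k) (k : ℤ) :
    spatialCoeff (opTN u t) k = ∑' κ, if altSum κ = k then coeffTN g κ else 0 := by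
  rw [← spatialCoeff_fourierSum (summable_coeffTN hg)]
  refine spatialCoeff_congr_ae ?_ k
  have hae : ∀ᵐ x, ∀ l, u l t x = fourierSum (g l) id x :=
    ae_all_iff.2 fun l => ae_eq_fourierSum (hint l) (hu l) (hg l)
  filter_upwards [hae] with x hx
  exact opTN_eq_fourierSum hg hu hx

end fixedTime

/-! ### Fourier transforms in time -/

/-- The function `t ↦ (2π)^{-1/2} ∫ g(τ) e^{itτ} dτ` with Fourier transform `g`. -/
noncomputable def timeTransform (g : ℝ → ℂ) (t : ℝ) : ℂ :=
  (Real.sqrt (2 * Real.pi) : ℂ)⁻¹ * ∫ τ : ℝ, g τ * Complex.exp (Complex.I * ((t * τ : ℝ) : ℂ))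

theorem norm_exp_I_mul (r : ℝ) : ‖Complex.exp (Complex.I * (r : ℂ))‖ = 1 := by
  rw [mul_comm]; exact Complex.norm_exp_ofReal_mul_I r

theorem integrable_mul_exp {g : ℝ → ℂ} (hg : Integrable g) (t : ℝ) :
    Integrable fun τ : ℝ => g τ * Complex.exp (Complex.I * ((t * τ : ℝ) : ℂ)) :=
  hg.mul_bdd (c := 1) (by apply Continuous.aestronglyMeasurable; fun_prop)
    (Filter.Eventually.of_forall fun τ => (norm_exp_I_mul _).le)

theorem norm_inv_sqrt_two_pi_le : ‖(Real.sqrt (2 * Real.pi) : ℂ)⁻¹‖ ≤ 1 := by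
  simpa [normFactor] using norm_normFactor_le 1

theorem norm_timeTransform_le (g : ℝ → ℂ) (t : ℝ) : ‖timeTransform g t‖ ≤ ∫ τ, ‖g τ‖ := by
  rw [timeTransform, norm_mul]
  refine (mul_le_of_le_one_left (norm_nonneg _) norm_inv_sqrt_two_pi_le).trans
    ((norm_integral_le_integral_norm _).trans_eq ?_)
  simp_rw [norm_mul, norm_exp_I_mul, mul_one]

theorem continuous_timeTransform {g : ℝ → ℂ} (hg : Integrable g) : Continuous (timeTransform g) := by
  refine continuous_const.mul (continuous_of_dominated (bound := fun τ => ‖g τ‖)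
    (fun t => (integrable_mul_exp hg t).aestronglyMeasurable)
    (fun t => Filter.Eventually.of_forall fun τ => ?_) hg.norm
    (Filter.Eventually.of_forall fun τ => by fun_prop))
  rw [norm_mul, norm_exp_I_mul, mul_one]

/-- For integrable `g`, the distribution with Fourier transform `g` is a function. -/
theorem timePairing_eq {g φ : ℝ → ℂ} (hg : Integrable g) (hφ : Integrable φ) :
    timePairing g φ = ∫ t, timeTransform g t * φ t := by
  have hprod : Integrable (fun z : ℝ × ℝ =>
      g z.1 * φ z.2 * Complex.exp (Complex.I * ((z.2 * z.1 : ℝ) : ℂ))) (volume.prod volume) :=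
    (hg.mul_prod hφ).mul_bdd (c := 1) (by apply Continuous.aestronglyMeasurable; fun_prop)
      (Filter.Eventually.of_forall fun z => (norm_exp_I_mul _).le)
  have hswap := integral_integral_swap (f := fun τ t : ℝ =>
    g τ * φ t * Complex.exp (Complex.I * ((t * τ : ℝ) : ℂ))) hprod
  have h1 : ∀ τ : ℝ, g τ * ∫ t : ℝ, φ t * Complex.exp (Complex.I * ((t * τ : ℝ) : ℂ))
      = ∫ t : ℝ, g τ * φ t * Complex.exp (Complex.I * ((t * τ : ℝ) : ℂ)) := fun τ => by
    simp_rw [mul_assoc]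
    rw [integral_const_mul]
  have h2 : ∀ t : ℝ, timeTransform g t * φ t = (Real.sqrt (2 * Real.pi) : ℂ)⁻¹ *
      ∫ τ : ℝ, g τ * φ t * Complex.exp (Complex.I * ((t * τ : ℝ) : ℂ)) := fun t => by
    have h3 : ∀ τ : ℝ, g τ * φ t * Complex.exp (Complex.I * ((t * τ : ℝ) : ℂ))
        = g τ * Complex.exp (Complex.I * ((t * τ : ℝ) : ℂ)) * φ t := fun τ => by ring
    simp_rw [h3]
    rw [integral_mul_const, timeTransform, mul_assoc]
  simp_rw [timePairing, h1, h2]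
  rw [integral_const_mul, hswap]

theorem timeTransform_tsum {ι : Type*} [Countable ι] {G : ι → ℝ → ℂ} (hG : ∀ i, Integrable (G i))
    (hsum : Summable fun i => ∫ τ, ‖G i τ‖) (t : ℝ) :
    timeTransform (fun τ => ∑' i, G i τ) t = ∑' i, timeTransform (G i) t := by
  have h := integral_tsum_of_summable_integral_norm (fun i => integrable_mul_exp (hG i) t) (by
    simpa only [norm_mul, norm_exp_I_mul, mul_one] using hsum)
  simp_rw [timeTransform, tsum_mul_left, h, ← tsum_mul_right]

theorem timeTransform_const_mul (c : ℂ) (g : ℝ → ℂ) (t : ℝ) :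
    timeTransform (fun τ => c * g τ) t = c * timeTransform g t := by
  simp_rw [timeTransform, mul_assoc, integral_const_mul]
  ring

/-- The factor of position `l` in the variable `x = ±τ`: `f` itself at odd positions; at even
positions the Fourier transform of the complex conjugate. -/
noncomputable def signedPart {p : ℕ} (l : Fin p) (f : ℝ → ℂ) (x : ℝ) : ℂ :=
  if Even l.val then f x else (starRingEnd ℂ) (f (-x))

theorem measurable_signedPart {p : ℕ} (l : Fin p) {f : ℝ → ℂ} (hf : Measurable f) :
    Measurable (signedPart l f) := by
  unfold signedPart; split_ifs
  · exact hf
  · exact Complex.continuous_conj.measurable.comp (hf.comp measurable_neg)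

theorem integrable_signedPart {p : ℕ} (l : Fin p) {f : ℝ → ℂ} (hf : Integrable f) :
    Integrable (signedPart l f) := by
  unfold signedPart; split_ifs
  · exact hf
  · exact (Complex.conjCLE.toContinuousLinearMap.integrable_comp hf.comp_neg)

theorem conjAt_timeTransform {p : ℕ} (l : Fin p) (f : ℝ → ℂ) (t : ℝ) :
    conjAt l (timeTransform f t) = timeTransform (signedPart l f) t := by
  unfold conjAt signedPart; split_ifs
  · rfl
  · rw [timeTransform, timeTransform, map_mul, map_inv₀, Complex.conj_ofReal, ← integral_conj,
      ← integral_neg_eq_self]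
    congr 1
    refine integral_congr_ae (Filter.Eventually.of_forall fun τ => ?_)
    simp only [map_mul, ← Complex.exp_conj, Complex.conj_I, Complex.conj_ofReal]
    congr 2
    push_cast
    ring

/-- The weight in the signed variable is the weight `⟨τ + k²⟩` after the reflection in `signedPart`. -/
theorem lintegral_weight_mul_signedPart {p : ℕ} (s b : ℝ) (l : Fin p) (k : ℤ) (f : ℝ → ℂ) :
    ∫⁻ x, weight (2 * s) (2 * b) l k x * ‖signedPart l f x‖ₑ ^ 2
      = ∫⁻ τ, outputWeight s b k τ * ‖f τ‖ₑ ^ 2 := by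
  unfold signedPart weight outputWeight modulation
  split_ifs with h
  · simp [h.neg_one_pow]
  · rw [← lintegral_neg_eq_self]
    refine lintegral_congr fun x => ?_
    rw [(Nat.not_even_iff_odd.1 h).neg_one_pow, neg_neg,
      show -x + -1 * (k : ℝ) ^ 2 = -(x + (k : ℝ) ^ 2) by ring, bracket_neg]
    simp [enorm_eq_nnnorm]

section fiberConv
variable {n : ℕ} {h : Fin (n + 1) → ℝ → ℂ}

/-- The convolution of `h₀, ..., hₙ`, as an integral over a hyperplane. -/
noncomputable def fiberConv (h : Fin (n + 1) → ℝ → ℂ) (τ : ℝ) : ℂ :=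
  ∫ y : Fin n → ℝ, ∏ l, h l (fiberPoint 0 τ y l)

theorem integrable_fiberConv (hh : ∀ l, Integrable (h l)) : Integrable (fiberConv h) :=
  (integrable_fiberPoint 0 (Integrable.fintype_prod hh)).integral_prod_left

theorem enorm_fiberConv_le (h : Fin (n + 1) → ℝ → ℂ) (τ : ℝ) :
    ‖fiberConv h τ‖ₑ ≤ ∫⁻ y, ∏ l, ‖h l (fiberPoint 0 τ y l)‖ₑ := by
  refine (enorm_integral_le_lintegral_enorm _).trans_eq (lintegral_congr fun y => ?_)
  simp_rw [enorm_eq_nnnorm, nnnorm_prod, ENNReal.ofNNReal_finsetProd]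

theorem lintegral_enorm_fiberConv_le (hm : ∀ l, Measurable (h l)) :
    ∫⁻ τ, ‖fiberConv h τ‖ₑ ≤ ∏ l, ∫⁻ x, ‖h l x‖ₑ := by
  have hm' : ∀ l, Measurable fun x => ‖h l x‖ₑ := fun l => (hm l).enorm
  have hQ : Measurable fun x : Fin (n + 1) → ℝ => ∏ l, ‖h l (x l)‖ₑ :=
    Finset.measurable_prod _ fun l _ => (hm' l).comp (measurable_pi_apply l)
  rw [← lintegral_pi_prod _ hm', ← lintegral_fiberPoint 0 hQ]
  exact lintegral_mono (enorm_fiberConv_le h)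

/-- Products in time are convolutions on the Fourier side. -/
theorem prod_timeTransform (hh : ∀ l, Integrable (h l)) (t : ℝ) :
    ∏ l, timeTransform (h l) t = normFactor n * timeTransform (fiberConv h) t := by
  have hi := Integrable.fintype_prod (μ := fun _ => volume) fun l => integrable_mul_exp (hh l) t
  simp_rw [timeTransform]
  rw [Finset.prod_mul_distrib, Finset.prod_const, Finset.card_univ, Fintype.card_fin, pow_succ,
    ← integral_fintype_prod_volume_eq_prod (fun l τ =>
      h l τ * Complex.exp (Complex.I * ((t * τ : ℝ) : ℂ))), ← integral_fiberPoint 0 hi, normFactor,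
    mul_assoc]
  congr 2
  refine integral_congr_ae (Filter.Eventually.of_forall fun τ => ?_)
  simp only [fiberConv]
  rw [← integral_mul_const]
  refine integral_congr_ae (Filter.Eventually.of_forall fun y => ?_)
  simp only
  rw [Finset.prod_mul_distrib, ← Complex.exp_sum, ← Finset.mul_sum, ← Complex.ofReal_sum,
    ← Finset.mul_sum, sum_fiberPoint]

end fiberConv

section transformTN
variable {n : ℕ} {f : Fin (n + 1) → ℤ → ℝ → ℂ}

/-- The space-time Fourier transform of `𝒯_N(u₁, ..., u_p)` in terms of those of `u₁, ..., u_p`. -/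
noncomputable def transformTN (f : Fin (n + 1) → ℤ → ℝ → ℂ) (k : ℤ) (τ : ℝ) : ℂ :=
  ∑' κ : Fin (n + 1) → ℤ, (if altSum κ = k then
    normFactor n * ((1 - (resonanceCount κ : ℂ)) * normFactor n) else 0) *
      fiberConv (fun l => signedPart l (f l (κ l))) τ

theorem lintegral_enorm_signedPart {p : ℕ} (l : Fin p) (f : ℝ → ℂ) :
    ∫⁻ x, ‖signedPart l f x‖ₑ = ∫⁻ x, ‖f x‖ₑ := by
  unfold signedPart; split_ifs
  · rfl
  · rw [← lintegral_neg_eq_self]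
    simp [enorm_eq_nnnorm]

theorem integrable_of_tsum_lt_top {F : ℤ → ℝ → ℂ} (hF : ∀ k, Measurable (F k))
    (hfin : ∑' k, ∫⁻ x, ‖F k x‖ₑ < ∞) (k : ℤ) : Integrable (F k) :=
  ⟨(hF k).aestronglyMeasurable, (ENNReal.le_tsum k).trans_lt hfin⟩

theorem summable_integral_norm {ι : Type*} {G : ι → ℝ → ℂ} (hG : ∀ i, Integrable (G i))
    (hfin : ∑' i, ∫⁻ x, ‖G i x‖ₑ < ∞) : Summable fun i => ∫ x, ‖G i x‖ := by
  refine (ENNReal.summable_toReal hfin.ne).congr fun i => ?_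
  exact (integral_norm_eq_lintegral_enorm (hG i).aestronglyMeasurable).symm

theorem enorm_coeff_le (κ : Fin (n + 1) → ℤ) :
    ‖normFactor n * ((1 - (resonanceCount κ : ℂ)) * normFactor n)‖ₑ ≤ ((n + 1 : ℕ) : ℝ≥0∞) := by
  have h : ‖normFactor n * ((1 - (resonanceCount κ : ℂ)) * normFactor n)‖ ≤ (n + 1 : ℕ) := by
    rw [norm_mul, norm_mul]
    exact (mul_le_of_le_one_left (by positivity) (norm_normFactor_le n)).trans
      ((mul_le_of_le_one_right (by positivity) (norm_normFactor_le n)).trans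
        (norm_one_sub_resonanceCount_le κ))
  rw [← ofReal_norm, ← ENNReal.ofReal_natCast]
  exact ENNReal.ofReal_le_ofReal h

theorem tsum_lintegral_terms_lt_top (hf : ∀ l k, Measurable (f l k))
    (hfin : ∀ l, ∑' k, ∫⁻ x, ‖f l k x‖ₑ < ∞) (k : ℤ) :
    ∑' κ : Fin (n + 1) → ℤ, ∫⁻ τ, ‖(if altSum κ = k then
      normFactor n * ((1 - (resonanceCount κ : ℂ)) * normFactor n) else 0) *
        fiberConv (fun l => signedPart l (f l (κ l))) τ‖ₑ < ∞ := by
  have h1 : ∀ κ : Fin (n + 1) → ℤ, ∫⁻ τ, ‖(if altSum κ = k then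
      normFactor n * ((1 - (resonanceCount κ : ℂ)) * normFactor n) else 0) *
        fiberConv (fun l => signedPart l (f l (κ l))) τ‖ₑ
      ≤ ((n + 1 : ℕ) : ℝ≥0∞) * ∏ l, ∫⁻ x, ‖f l (κ l) x‖ₑ := by
    intro κ
    simp_rw [enorm_mul]
    rw [lintegral_const_mul' _ _ enorm_ne_top]
    gcongr
    · split_ifs
      · exact enorm_coeff_le κ
      · simp
    · refine (lintegral_enorm_fiberConv_le fun l => measurable_signedPart l (hf l (κ l))).trans_eq ?_
      simp_rw [lintegral_enorm_signedPart]
  refine (ENNReal.tsum_le_tsum h1).trans_lt ?_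
  rw [ENNReal.tsum_mul_left, tsum_pi_prod_ennreal (fun l k => ∫⁻ x, ‖f l k x‖ₑ)]
  exact ENNReal.mul_lt_top (ENNReal.natCast_lt_top _) (ENNReal.prod_lt_top fun l _ => hfin l)

theorem integrable_terms (hf : ∀ l k, Measurable (f l k))
    (hfin : ∀ l, ∑' k, ∫⁻ x, ‖f l k x‖ₑ < ∞) (k : ℤ) (κ : Fin (n + 1) → ℤ) :
    Integrable fun τ => (if altSum κ = k then
      normFactor n * ((1 - (resonanceCount κ : ℂ)) * normFactor n) else 0) *
        fiberConv (fun l => signedPart l (f l (κ l))) τ :=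
  (integrable_fiberConv fun l => integrable_signedPart l
    (integrable_of_tsum_lt_top (hf l) (hfin l) (κ l))).const_mul _

theorem measurable_fiberConv {h : Fin (n + 1) → ℝ → ℂ} (hm : ∀ l, Measurable (h l)) :
    Measurable (fiberConv h) := by
  have h1 : Measurable fun z : ℝ × (Fin n → ℝ) => ∏ l, h l (fiberPoint 0 z.1 z.2 l) :=
    Finset.measurable_prod _ fun l _ => (hm l).comp
      ((measurable_pi_apply l).comp (measurePreserving_fiberPoint 0).measurable)
  exact (h1.stronglyMeasurable.integral_prod_right).measurable

theorem measurable_transformTN (hf : ∀ l k, Measurable (f l k)) (k : ℤ) :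
    Measurable (transformTN f k) :=
  Measurable.tsum fun κ => (measurable_fiberConv fun l =>
    measurable_signedPart l (hf l (κ l))).const_mul _

theorem integrable_transformTN (hf : ∀ l k, Measurable (f l k))
    (hfin : ∀ l, ∑' k, ∫⁻ x, ‖f l k x‖ₑ < ∞) (k : ℤ) : Integrable (transformTN f k) := by
  refine ⟨(measurable_transformTN hf k).aestronglyMeasurable, ?_⟩
  refine (lintegral_mono fun τ => enorm_tsum_le_tsum_enorm).trans_lt ?_
  rw [lintegral_tsum fun κ => (integrable_terms hf hfin k κ).aestronglyMeasurable.enorm]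
  exact tsum_lintegral_terms_lt_top hf hfin k

/-- `transformTN` is the space-time Fourier transform of the function with the spatial Fourier
coefficients of `𝒯_N`. -/
theorem timeTransform_transformTN (hf : ∀ l k, Measurable (f l k))
    (hfin : ∀ l, ∑' k, ∫⁻ x, ‖f l k x‖ₑ < ∞) (k : ℤ) (t : ℝ) :
    timeTransform (transformTN f k) t =
      ∑' κ, if altSum κ = k then coeffTN (fun l k => timeTransform (f l k) t) κ else 0 := by
  have h1 := timeTransform_tsum (integrable_terms hf hfin k)
    (summable_integral_norm (integrable_terms hf hfin k) (tsum_lintegral_terms_lt_top hf hfin k)) t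
  refine h1.trans (tsum_congr fun κ => ?_)
  rw [timeTransform_const_mul]
  split_ifs
  · rw [coeffTN]
    simp_rw [conjAt_timeTransform]
    rw [prod_timeTransform fun l => integrable_signedPart l
      (integrable_of_tsum_lt_top (hf l) (hfin l) (κ l))]
    ring
  · rw [zero_mul]

/-- Single resonances have the coefficient `1 - 1 = 0`, so only `nonSingle` frequencies remain. -/
theorem enorm_transformTN_le (f : Fin (n + 1) → ℤ → ℝ → ℂ) (k : ℤ) (τ : ℝ) :
    ‖transformTN f k τ‖ₑ ≤ ((n + 1 : ℕ) : ℝ≥0∞) * ∑' κ : nonSingle n k, ∫⁻ y,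
      ∏ l, ‖signedPart l (f l (κ.val l)) (fiberPoint 0 τ y l)‖ₑ := by
  refine enorm_tsum_le_tsum_enorm.trans ?_
  rw [tsum_subtype (nonSingle n k) fun κ => ∫⁻ y,
      ∏ l, ‖signedPart l (f l (κ l)) (fiberPoint 0 τ y l)‖ₑ, ← ENNReal.tsum_mul_left]
  refine ENNReal.tsum_le_tsum fun κ => ?_
  by_cases hκ : κ ∈ nonSingle n k
  · rw [indicator_of_mem hκ, if_pos (And.left hκ), enorm_mul]
    gcongr
    · exact enorm_coeff_le κ
    · exact enorm_fiberConv_le _ _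
  · have h0 : (if altSum κ = k then
        normFactor n * ((1 - (resonanceCount κ : ℂ)) * normFactor n) else 0) = 0 := by
      split_ifs with h
      · have h1 : resonanceCount κ = 1 := by
          by_contra h1
          exact hκ ⟨h, h1⟩
        simp [h1]
      · rfl
    rw [h0]
    simp

/-- The multilinear estimate in terms of space-time Fourier transforms. -/
theorem tsum_lintegral_transformTN_le {s b σ b' : ℝ} (hs : 0 ≤ s) (hσ : 0 ≤ σ)
    (hσb : σ ≤ b) (hσb' : σ ≤ b') (hf : ∀ l k, Measurable (f l k)) :
    ∑' k : ℤ, ∫⁻ τ, outputWeight (s + σ) (-b') k τ * ‖transformTN f k τ‖ₑ ^ 2 ≤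
      ((n + 1 : ℕ) : ℝ≥0∞) ^ 2 * smoothingConst n s b σ *
        ∏ l, ∑' k, ∫⁻ τ, outputWeight s b k τ * ‖f l k τ‖ₑ ^ 2 := by
  have h := tsum_lintegral_outputWeight_le hs hσ hσb hσb'
    (fun l k x => ‖signedPart l (f l k) x‖ₑ) fun l k => (measurable_signedPart l (hf l k)).enorm
  simp_rw [lintegral_weight_mul_signedPart] at h
  rw [mul_assoc]
  refine le_trans ?_ (mul_le_mul_right h _)
  rw [← ENNReal.tsum_mul_left]
  refine ENNReal.tsum_le_tsum fun k => ?_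
  rw [← lintegral_const_mul' _ _ (by finiteness)]
  refine lintegral_mono fun τ => ?_
  rw [mul_left_comm, ← mul_pow]
  gcongr
  exact enorm_transformTN_le f k τ

end transformTN

/-! ### Extensions of `𝒯_N` and the infimum over extensions -/

theorem timePairing_congr_ae {g g' : ℝ → ℂ} (h : g =ᵐ[volume] g') (φ : ℝ → ℂ) :
    timePairing g φ = timePairing g' φ := by
  rw [timePairing, timePairing]
  congr 1
  refine integral_congr_ae ?_
  filter_upwards [h] with τ hτ
  rw [hτ]

section restriction
variable {T : ℝ} {u : ℝ → Torus → ℂ} {f : ℤ → ℝ → ℂ}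

theorem integrable_prod_of_isCompact
    (hu : LocallyIntegrableOn (Function.uncurry u) (Ioo 0 T ×ˢ univ) volume) {K : Set ℝ}
    (hK : IsCompact K) (hKT : K ⊆ Ioo 0 T) :
    Integrable (Function.uncurry u) ((volume.restrict K).prod volume) := by
  have h := hu.integrableOn_compact_subset (prod_mono hKT (subset_univ (univ : Set Torus)))
    (hK.prod isCompact_univ)
  rwa [IntegrableOn, Measure.volume_eq_prod, ← Measure.prod_restrict, Measure.restrict_univ] at h

theorem ae_integrable_slice
    (hu : LocallyIntegrableOn (Function.uncurry u) (Ioo 0 T ×ˢ univ) volume) :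
    ∀ᵐ t, t ∈ Ioo 0 T → Integrable (u t) := by
  have h : ∀ m : ℕ, ∀ᵐ t, t ∈ Icc (1 / ((m : ℝ) + 1)) (T - 1 / ((m : ℝ) + 1)) →
      Integrable (u t) := fun m => by
    have hm : 0 < 1 / ((m : ℝ) + 1) := Nat.one_div_pos_of_nat
    have hI := integrable_prod_of_isCompact hu
      (isCompact_Icc (a := 1 / ((m : ℝ) + 1)) (b := T - 1 / ((m : ℝ) + 1)))
      (fun t ht => ⟨hm.trans_le ht.1, by linarith [ht.2]⟩)
    exact (ae_restrict_iff' measurableSet_Icc).1 hI.prod_right_ae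
  filter_upwards [ae_all_iff.2 h] with t ht htT
  obtain ⟨m, hm⟩ := exists_nat_one_div_lt (lt_min htT.1 (sub_pos.2 htT.2))
  exact ht m ⟨(hm.trans_le (min_le_left _ _)).le, by linarith [hm.trans_le (min_le_right _ _)]⟩

theorem integrableOn_spatialCoeff
    (hu : LocallyIntegrableOn (Function.uncurry u) (Ioo 0 T ×ˢ univ) volume) (k : ℤ) {K : Set ℝ}
    (hK : IsCompact K) (hKT : K ⊆ Ioo 0 T) : IntegrableOn (fun t => spatialCoeff (u t) k) K := by
  have h := (integrable_prod_of_isCompact hu hK hKT).mul_bdd (c := 1)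
    (g := fun z : ℝ × Torus => (fourier (-k) z.2 : ℂ))
    (((map_continuous (fourier (-k))).comp continuous_snd).aestronglyMeasurable)
    (Filter.Eventually.of_forall fun z => (norm_fourier_apply _ _).le)
  exact h.integral_prod_left.const_mul _

/-- Inside `(0,T)`, the spatial Fourier coefficients are given by Fourier inversion in time: both sides
are locally integrable and agree as distributions. -/
theorem IsExtension.ae_spatialCoeff_eq (hE : IsExtension T u f) {k : ℤ} (hf : Integrable (f k)) :
    ∀ᵐ t, t ∈ Ioo 0 T → spatialCoeff (u t) k = timeTransform (f k) t := by
  have hcont := continuous_timeTransform hf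
  have hloc : LocallyIntegrableOn (fun t => spatialCoeff (u t) k - timeTransform (f k) t)
      (Ioo 0 T) volume := by
    rw [locallyIntegrableOn_iff isOpen_Ioo.isLocallyClosed]
    exact fun K hKT hK => (integrableOn_spatialCoeff hE.locallyIntegrableOn k hK hKT).sub
      (hcont.continuousOn.integrableOn_compact hK)
  have h := isOpen_Ioo.ae_eq_zero_of_integral_contDiff_smul_eq_zero hloc fun g hg hgc hgT => by
    have hφc : HasCompactSupport fun t => (g t : ℂ) := hgc.comp_left Complex.ofReal_zero
    have hφd : ContDiff ℝ (⊤ : ℕ∞) fun t => (g t : ℂ) := Complex.ofRealCLM.contDiff.comp hg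
    have hφt : tsupport (fun t => (g t : ℂ)) ⊆ tsupport g :=
      closure_mono fun t ht h0 => ht (by simp [h0])
    have hφ : Continuous fun t => (g t : ℂ) := Complex.continuous_ofReal.comp hg.continuous
    have hi1 : Integrable fun t => spatialCoeff (u t) k * (g t : ℂ) := by
      obtain ⟨C, hC⟩ := hφ.bounded_above_of_compact_support hφc
      refine (integrableOn_iff_integrable_of_support_subset (s := tsupport g) ?_).1
        (Integrable.mul_bdd (c := C) (integrableOn_spatialCoeff hE.locallyIntegrableOn k hgc hgT)
          hφ.aestronglyMeasurable (Filter.Eventually.of_forall hC))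
      intro t ht
      refine subset_tsupport g fun h0 => ht ?_
      simp [h0]
    have hi2 : Integrable fun t => timeTransform (f k) t * (g t : ℂ) :=
      (hcont.mul hφ).integrable_of_hasCompactSupport hφc.mul_left
    have h1 := hE.eq_on k _ hφd hφc (hφt.trans hgT)
    rw [timePairing_eq hf (hφ.integrable_of_hasCompactSupport hφc)] at h1
    simp_rw [Complex.real_smul, mul_sub, mul_comm ((g _ : ℝ) : ℂ)]
    rw [integral_sub hi1 hi2, h1, sub_self]
  filter_upwards [h] with t ht htT
  exact sub_eq_zero.1 (ht htT)

theorem IsExtension.congr_ae (hE : IsExtension T u f) {f' : ℤ → ℝ → ℂ}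
    (hff' : ∀ k, f k =ᵐ[volume] f' k) : IsExtension T u f' where
  aestronglyMeasurable k := (hE.aestronglyMeasurable k).congr (hff' k)
  locallyIntegrableOn := hE.locallyIntegrableOn
  eq_on k φ h1 h2 h3 := (hE.eq_on k φ h1 h2 h3).trans (timePairing_congr_ae (hff' k) φ)

theorem bourgainNorm_congr_ae {f' : ℤ → ℝ → ℂ} (s b : ℝ) (hff' : ∀ k, f k =ᵐ[volume] f' k) :
    bourgainNorm s b f = bourgainNorm s b f' := by
  rw [bourgainNorm, bourgainNorm]
  congr 1
  refine tsum_congr fun k => lintegral_congr_ae ?_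
  filter_upwards [hff' k] with τ hτ
  rw [hτ]

end restriction

section extensionTN
variable {n : ℕ} {T : ℝ} {u : Fin (n + 1) → ℝ → Torus → ℂ} {f : Fin (n + 1) → ℤ → ℝ → ℂ}

theorem norm_timeTransform_summable {F : ℤ → ℝ → ℂ} (hF : ∀ k, Measurable (F k))
    (hfin : ∑' k, ∫⁻ x, ‖F k x‖ₑ < ∞) (t : ℝ) : Summable fun k => ‖timeTransform (F k) t‖ :=
  Summable.of_nonneg_of_le (fun _ => norm_nonneg _) (fun k => norm_timeTransform_le (F k) t)
    (summable_integral_norm (fun k => integrable_of_tsum_lt_top hF hfin k) hfin)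

/-- If the extensions have summable integrable Fourier transforms, then the functions coincide
almost everywhere on `(0,T) × 𝕋` with the sums of their Fourier series. -/
theorem IsExtension.ae_eq_fourierSum {u : ℝ → Torus → ℂ} {F : ℤ → ℝ → ℂ} (hE : IsExtension T u F)
    (hF : ∀ k, Measurable (F k)) (hfin : ∑' k, ∫⁻ x, ‖F k x‖ₑ < ∞) :
    ∀ᵐ z : ℝ × Torus ∂(volume.restrict (Ioo 0 T)).prod volume,
      u z.1 z.2 = fourierSum (fun k => timeTransform (F k) z.1) id z.2 := by
  have hsum := summable_integral_norm (fun k => integrable_of_tsum_lt_top hF hfin k) hfin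
  have hcont : Continuous fun z : ℝ × Torus =>
      fourierSum (fun k => timeTransform (F k) z.1) id z.2 :=
    continuous_fourierSum
      (fun k => continuous_timeTransform (integrable_of_tsum_lt_top hF hfin k)) hsum
      (fun t k => norm_timeTransform_le (F k) t) id
  have hm : AEStronglyMeasurable (Function.uncurry u)
      ((volume.restrict (Ioo 0 T)).prod volume) := by
    have h := hE.locallyIntegrableOn.aestronglyMeasurable
    rwa [Measure.volume_eq_prod, ← Measure.prod_restrict, Measure.restrict_univ] at h
  -- A measurable representative is needed to pass from slices to the product.
  have h1 : ∀ᵐ z : ℝ × Torus ∂(volume.restrict (Ioo 0 T)).prod volume,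
      hm.mk _ z = fourierSum (fun k => timeTransform (F k) z.1) id z.2 := by
    rw [Measure.ae_prod_iff_ae_ae
      (measurableSet_eq_fun hm.stronglyMeasurable_mk.measurable hcont.measurable)]
    filter_upwards [Measure.ae_ae_of_ae_prod hm.ae_eq_mk,
      ae_restrict_of_ae (ae_integrable_slice hE.locallyIntegrableOn),
      ae_restrict_of_ae (ae_all_iff.2 fun k => hE.ae_spatialCoeff_eq
        (integrable_of_tsum_lt_top hF hfin k)), ae_restrict_mem measurableSet_Ioo]
      with t ht1 ht2 ht3 htT
    have h2 := NLSBourgain.ae_eq_fourierSum (ht2 htT) (fun k => ht3 k htT)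
      (norm_timeTransform_summable hF hfin t)
    filter_upwards [ht1, h2] with x hx1 hx2
    rw [← hx1, ← hx2]
    rfl
  filter_upwards [h1, hm.ae_eq_mk] with z hz1 hz2
  rw [← hz1, ← hz2]
  rfl

/-- The local integrability comes from an almost everywhere equal function that is continuous on all of
`ℝ × 𝕋`, the sum over `κ` with the Fourier inversions of the `f l` in place of the coefficients. -/
theorem isExtension_opTN (hE : ∀ l, IsExtension T (u l) (f l)) (hf : ∀ l k, Measurable (f l k))
    (hfin : ∀ l, ∑' k, ∫⁻ x, ‖f l k x‖ₑ < ∞) :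
    IsExtension T (opTN u) (transformTN f) := by
  have hint := fun l k => integrable_of_tsum_lt_top (hf l) (hfin l) k
  have hg := fun l t => norm_timeTransform_summable (hf l) (hfin l) t
  have hcoef : ∀ᵐ t, ∀ l, t ∈ Ioo 0 T → ∀ k,
      spatialCoeff (u l t) k = timeTransform (f l k) t := by
    refine ae_all_iff.2 fun l => ?_
    filter_upwards [ae_all_iff.2 fun k => (hE l).ae_spatialCoeff_eq (hint l k)] with t ht htT k
    exact ht k htT
  refine ⟨fun k => (measurable_transformTN hf k).aestronglyMeasurable, ?_, ?_⟩
  · have hsum := fun l => summable_integral_norm (hint l) (hfin l)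
    have hcont : Continuous fun z : ℝ × Torus =>
        fourierSum (coeffTN fun l k => timeTransform (f l k) z.1) altSum z.2 := by
      refine continuous_fourierSum
        (A := fun t => coeffTN fun l k => timeTransform (f l k) t)
        (u := fun κ : Fin (n + 1) → ℤ => ((n + 1 : ℕ) : ℝ) * ∏ l, ∫ τ, ‖f l (κ l) τ‖)
        (fun κ => ?_) ?_ (fun t κ => ?_) altSum
      · refine continuous_const.mul (continuous_const.mul (continuous_finsetProd _ fun l _ =>
          (continuous_conjAt l).comp (continuous_timeTransform (hint l (κ l)))))
      · have hnn : ∀ l k, ‖∫ τ, ‖f l k τ‖‖ = ∫ τ, ‖f l k τ‖ := fun l k =>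
          Real.norm_of_nonneg (integral_nonneg fun _ => norm_nonneg _)
        have h := summable_pi_prod_norm (fun l k => ((∫ τ, ‖f l k τ‖ : ℝ) : ℂ)) fun l => by
          simpa only [Complex.norm_real, hnn] using (hsum l)
        refine Summable.mul_left _ (h.congr fun κ => ?_)
        rw [norm_prod]
        simp only [Complex.norm_real, hnn]
      · refine (norm_coeffTN_le κ).trans ?_
        gcongr
        exact norm_timeTransform_le _ _
    have hae : ∀ᵐ z : ℝ × Torus ∂(volume.restrict (Ioo 0 T)).prod volume,
        fourierSum (coeffTN fun l k => timeTransform (f l k) z.1) altSum z.2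
          = Function.uncurry (opTN u) z := by
      have h1 : ∀ᵐ z : ℝ × Torus ∂(volume.restrict (Ioo 0 T)).prod volume, ∀ l k,
          spatialCoeff (u l z.1) k = timeTransform (f l k) z.1 := by
        have h2 : ∀ᵐ t ∂volume.restrict (Ioo 0 T), ∀ l k,
            spatialCoeff (u l t) k = timeTransform (f l k) t := by
          filter_upwards [ae_restrict_of_ae hcoef, ae_restrict_mem measurableSet_Ioo]
            with t ht htT l k
          exact ht l htT k
        exact Measure.quasiMeasurePreserving_fst.ae h2
      filter_upwards [h1, ae_all_iff.2 fun l => (hE l).ae_eq_fourierSum (hf l) (hfin l)]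
        with z hz1 hz2
      exact (opTN_eq_fourierSum (fun l => hg l z.1) hz1 hz2).symm
    rw [locallyIntegrableOn_iff (isOpen_Ioo.prod isOpen_univ).isLocallyClosed]
    intro K hKT hK
    refine Integrable.congr (hcont.continuousOn.integrableOn_compact hK) ?_
    refine ae_mono (Measure.restrict_mono_set _ hKT) ?_
    rw [Measure.volume_eq_prod, ← Measure.prod_restrict, Measure.restrict_univ]
    exact hae
  · intro k φ hφd hφc hφT
    rw [timePairing_eq (integrable_transformTN hf hfin k)
      (hφd.continuous.integrable_of_hasCompactSupport hφc)]
    refine integral_congr_ae ?_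
    filter_upwards [hcoef, ae_all_iff.2 fun l => ae_integrable_slice (hE l).locallyIntegrableOn]
      with t ht1 ht2
    by_cases htT : t ∈ Ioo 0 T
    · rw [timeTransform_transformTN hf hfin, spatialCoeff_opTN (fun l => ht2 l htT)
        (fun l => hg l t) fun l => ht1 l htT]
    · have : φ t = 0 := by
        by_contra h0
        exact htT (hφT (subset_tsupport φ h0))
      simp [this]

theorem bourgainNorm_sq (s b : ℝ) (F : ℤ → ℝ → ℂ) :
    bourgainNorm s b F ^ 2 = ∑' k, ∫⁻ τ, outputWeight s b k τ * ‖F k τ‖ₑ ^ 2 := by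
  rw [bourgainNorm, ← ENNReal.rpow_two, ← ENNReal.rpow_mul]
  norm_num [outputWeight]

/-- The smoothing estimate for given extensions. -/
theorem restrictedNorm_opTN_le {s b σ b' : ℝ} (hs : 1 < 2 * (s - σ)) (hb : 1 < 2 * b) (hσ : 0 ≤ σ)
    (hσb : σ ≤ b) (hσb' : σ ≤ b') (hE : ∀ l, IsExtension T (u l) (f l))
    (hfin : ∀ l, bourgainNorm s b (f l) < ∞) :
    restrictedNorm T (s + σ) (-b') (opTN u) ≤
      (((n + 1 : ℕ) : ℝ≥0∞) ^ 2 * smoothingConst n s b σ) ^ (1 / 2 : ℝ) *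
        ∏ l, bourgainNorm s b (f l) := by
  have hae : ∀ l k, f l k =ᵐ[volume] ((hE l).aestronglyMeasurable k).mk (f l k) := fun l k =>
    ((hE l).aestronglyMeasurable k).ae_eq_mk
  have hm : ∀ l k, Measurable (((hE l).aestronglyMeasurable k).mk (f l k)) := fun l k =>
    ((hE l).aestronglyMeasurable k).stronglyMeasurable_mk.measurable
  set F : Fin (n + 1) → ℤ → ℝ → ℂ := fun l k => ((hE l).aestronglyMeasurable k).mk (f l k)
  have hN : ∀ l, bourgainNorm s b (f l) = bourgainNorm s b (F l) := fun l =>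
    bourgainNorm_congr_ae s b (hae l)
  simp_rw [hN] at hfin ⊢
  have hL1 : ∀ l, ∑' k, ∫⁻ x, ‖F l k x‖ₑ < ∞ := fun l => by
    have h := tsum_lintegral_lt_top (s := s) (b := b) (by linarith) hb l
      (fun k x => ‖signedPart l (F l k) x‖ₑ) (fun k => (measurable_signedPart l (hm l k)).enorm) (by
        simp_rw [lintegral_weight_mul_signedPart, ← bourgainNorm_sq]
        exact ENNReal.pow_lt_top (hfin l))
    simpa only [lintegral_enorm_signedPart] using h
  refine (iInf₂_le _ (isExtension_opTN (fun l => (hE l).congr_ae (hae l)) hm hL1)).trans ?_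
  have h := tsum_lintegral_transformTN_le (s := s) (b := b) (by linarith) hσ hσb hσb' hm
  simp_rw [← bourgainNorm_sq] at h
  have hsqrt : ∀ x : ℝ≥0∞, (x ^ 2) ^ (1 / 2 : ℝ) = x := fun x => by
    rw [← ENNReal.rpow_two, ← ENNReal.rpow_mul]; norm_num
  have h2 := ENNReal.rpow_le_rpow h (by norm_num : (0 : ℝ) ≤ 1 / 2)
  rwa [hsqrt, ENNReal.mul_rpow_of_nonneg _ _ (by norm_num), Finset.prod_pow, hsqrt] at h2

end extensionTN

/-- A multilinear bound for all extensions of finite norm passes to the infimum. -/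
theorem le_mul_prod_restrictedNorm {p : ℕ} {T s b : ℝ} {u : Fin p → ℝ → Torus → ℂ}
    (hu : ∀ l, MemRestricted T s b (u l)) {A C : ℝ≥0∞} (hC : C ≠ ∞)
    (h : ∀ f : Fin p → ℤ → ℝ → ℂ, (∀ l, IsExtension T (u l) (f l)) →
      (∀ l, bourgainNorm s b (f l) < ∞) → A ≤ C * ∏ l, bourgainNorm s b (f l)) :
    A ≤ C * ∏ l, restrictedNorm T s b (u l) := by
  have key : ∀ ε : NNReal, 0 < ε → A ≤ C * ∏ l, (restrictedNorm T s b (u l) + ε) := by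
    intro ε hε
    have hex : ∀ l, ∃ f, IsExtension T (u l) f ∧
        bourgainNorm s b f < restrictedNorm T s b (u l) + ε := fun l => by
      have hlt : restrictedNorm T s b (u l) < restrictedNorm T s b (u l) + ε :=
        ENNReal.lt_add_right (hu l).ne (by simpa using hε.ne')
      conv_lhs at hlt => rw [restrictedNorm]
      simp only [iInf_lt_iff] at hlt
      obtain ⟨f, hf, hlt⟩ := hlt
      exact ⟨f, hf, hlt⟩
    choose f hf hlt using hex
    refine (h f hf fun l => (hlt l).trans (ENNReal.add_lt_top.2 ⟨hu l, ENNReal.coe_lt_top⟩)).trans ?_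
    gcongr with l
    exact (hlt l).le
  have hlim : Filter.Tendsto
      (fun ε : ℝ≥0∞ => C * ∏ l, (restrictedNorm T s b (u l) + ε)) (nhdsWithin 0 (Ioi 0))
      (nhds (C * ∏ l, (restrictedNorm T s b (u l) + 0))) := by
    refine ENNReal.Tendsto.const_mul (tendsto_nhdsWithin_of_tendsto_nhds ?_) (Or.inr hC)
    refine ENNReal.tendsto_finsetProd_of_ne_top _ (fun l _ => ?_) fun l _ => ?_
    · exact tendsto_const_nhds.add Filter.tendsto_id
    · simpa using (hu l).ne
  simp only [add_zero] at hlim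
  refine ge_of_tendsto hlim ?_
  filter_upwards [self_mem_nhdsWithin, mem_nhdsWithin_of_mem_nhds (Iio_mem_nhds ENNReal.zero_lt_top)]
    with ε hε hε'
  lift ε to NNReal using hε'.ne
  exact key ε (by simpa using hε)

end NLSBourgain

theorem lemma2p6 (p : ℕ) (hp : Odd p) (hp3 : 3 ≤ p) (T s b σ b' : ℝ) (hT : 0 < T) (hs : 1 ≤ s)
    (hb : 1 / 2 < b) (hσ0 : 0 < σ) (hσ : σ ≤ 1 / 4) (hσb' : σ ≤ b') (hb' : b' < 1 / 2) :
    ∃ C : ℝ, 0 < C ∧ ∀ u : Fin p → ℝ → NLSBourgain.Torus → ℂ,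
      (∀ l, NLSBourgain.MemRestricted T s b (u l)) →
        NLSBourgain.MemRestricted T (s + σ) (-b') (NLSBourgain.opTN u) ∧
        NLSBourgain.restrictedNorm T (s + σ) (-b') (NLSBourgain.opTN u) ≤
          ENNReal.ofReal C * ∏ l, NLSBourgain.restrictedNorm T s b (u l) := by
  obtain ⟨n, rfl⟩ : ∃ n, p = n + 1 := ⟨p - 1, by omega⟩
  set K : ℝ≥0∞ := (((n + 1 : ℕ) : ℝ≥0∞) ^ 2 * NLSBourgain.smoothingConst n s b σ) ^ (1 / 2 : ℝ)
  have hK : K ≠ ∞ := ENNReal.rpow_ne_top_of_nonneg (by norm_num) (ENNReal.mul_ne_top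
    (by finiteness) (NLSBourgain.smoothingConst_lt_top (by linarith) (by linarith)).ne)
  have hKC : K ≤ ENNReal.ofReal (K.toReal + 1) := by
    rw [ENNReal.le_ofReal_iff_toReal_le hK (by positivity)]
    linarith
  refine ⟨K.toReal + 1, by positivity, fun u hu => ?_⟩
  have hle : NLSBourgain.restrictedNorm T (s + σ) (-b') (NLSBourgain.opTN u) ≤
      ENNReal.ofReal (K.toReal + 1) * ∏ l, NLSBourgain.restrictedNorm T s b (u l) :=
    (NLSBourgain.le_mul_prod_restrictedNorm hu hK fun f hf hfin =>
      NLSBourgain.restrictedNorm_opTN_le (by linarith) (by linarith) hσ0.le (by linarith) hσb'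
        hf hfin).trans (mul_le_mul_left hKC _)
  exact ⟨hle.trans_lt (ENNReal.mul_lt_top ENNReal.ofReal_lt_top
    (ENNReal.prod_lt_top fun l _ => hu l)), hle⟩
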